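/- Let $s=s(N)$, $N=0,1,2,\dots$, be finite real numbers with $s(N)>N$ such that the limits $\lambda:=\lim_{N\to\infty}N/s(N)\in[0,1]$ and $c:=\lim_{N\to\infty}(s(N)-N)\in[1,\infty]$ exist, and put $c^{-1}:=0$ if $c=\infty$. Put $w_s(z):=\max\{1,|z|\}^{-s}$, and for real polynomials $f,g$ let $$\langle f|g\rangle:=\int_{\mathbb R}\int_{\mathbb R}w_s(x)w_s(y)f(x)g(y)\,\mathrm{sgn}(y-x)\,dx\,dy-2\mathrm i\int_{\mathbb C}\max\{1,|z|\}^{-2s}\,\overline{f(z)}\,g(z)\,\mathrm{sgn}(\operatorname{Im}z)\,dA(z),$$ where $dA$ is planar Lebesgue measure. For each $N$ let $p_0,p_1,\dots$ be any monic real polynomials with $\deg p_n=n$ (they may depend on $N$); the kernel defined next does not depend on their choice. For even $M$, with $\mathbf U=[\langle p_{m-1}|p_{n-1}\rangle]_{m,n=1}^{M}$ and $\mathbf U^{-1}=[\mu_{m,n}]$, let $$\varkappa_{M}(u,v):=-2\,w_s(u)w_s(v)\sum_{m,n=1}^{M}\mu_{m,n}\,p_{m-1}(u)\,p_{n-1}(v),\qquad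 u,v\in\mathbb C .$$ For odd $N=2J+1$ let $$\varkappa_{2J+1}(u,v):=\varkappa_{2J}(u,v)-2\sum_{j=0}^{J-1}\frac{s_{2j}}{s_{2J}}\big[\widetilde\pi_{2J}(u)\widetilde\pi_{2j+1}(v)-\widetilde\pi_{2J}(v)\widetilde\pi_{2j+1}(u)\big],$$ where $\varkappa_{2J}$ is formed with the same $s=s(N)$, $\widetilde\pi_k:=\pi_k w_s$, $s_{k}:=\int_{\mathbb R}\widetilde\pi_{k}(x)\,dx$, and $\pi_k$ are the skew-orthonormal polynomials of $\langle\cdot|\cdot\rangle$ given by $$\pi_{2n}(z)=\frac2\pi\sum_{k=0}^n\frac{\Gamma(k+\frac32)\Gamma(n-k+\frac12)}{\Gamma(k+1)\Gamma(n-k+1)}z^{2k},\qquad \pi_{2n+1}(z)=-\frac1{2\pi}\sum_{k=0}^n\frac{s-(2k+2)}{2s}\,\frac{\Gamma(k+\frac32)\Gamma(n-k-\frac12)}{\Gamma(k+1)\Gamma(n-k+1)}z^{2k+1}.$$ ($\varkappa_N$, formed with $s=s(N)$, is the $(1,1)$-entry of the matrix kernel of the Pfaffian point process of roots of a random real monic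 polynomial of degree $N$ with density proportional to (Mahler measure)$^{-s}$.) Let $\mathbb O:=\{z\in\mathbb C:|z|>1\}$, and let $\sqrt{u^2-1}$ denote the branch holomorphic in $\mathbb C\setminus[-1,1]$ with $\sqrt{u^2-1}\sim u$ at infinity. Then, as $N\to\infty$ through all integers and locally uniformly for $(u,v)\in\mathbb O\times\mathbb O$, $$\lim_{N\to\infty}\frac{|uv|^{s}}{(uv)^N}\,\frac{\varkappa_N(u,v)}{s-N}=\frac\lambda\pi\left[1+\frac{c^{-1}}{uv-1}\right]\frac1{uv-1}\,\frac{v-u}{\sqrt{u^2-1}\sqrt{v^2-1}} .$$ Consequently, if $c=\infty$, then $\varkappa_N(u,v)\to0$ locally uniformly in $\mathbb O\times\mathbb O$; while if $c<\infty$, then, locally uniformly in $\mathbb O\times\mathbb O$, $$\lim_{N\to\infty}\frac{|uv|^N}{(uv)^N}\,\varkappa_N(u,v)=\frac1\pi\left[c+\frac1{uv-1}\right]\frac1{|uv|^{c}}\,\frac1{uv-1}\,\frac{v-u}{\sqrt{u^2-1}\sqrt{v^2-1}} .$$ -/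

import Mathlib

noncomputable section

namespace RealMahler

/-- The weight `max {1, |z|} ^ (-s)` on the complex plane. -/
def weight (s : ℝ) (z : ℂ) : ℝ := (max 1 ‖z‖) ^ (-s)

/-- The real part of the skew-symmetric form:
`∫∫ max{1,|x|}^(-s) max{1,|y|}^(-s) f(x) g(y) sgn(y - x) dx dy` over `ℝ × ℝ`. -/
def skewFormReal (s : ℝ) (f g : Polynomial ℝ) : ℝ :=
  ∫ x : ℝ, ∫ y : ℝ,
    (max 1 |x|) ^ (-s) * (max 1 |y|) ^ (-s) * f.eval x * g.eval y * Real.sign (y - x)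

/-- The complex part of the skew-symmetric form:
`-2i ∫ max{1,|z|}^(-2s) conj(f(z)) g(z) sgn(Im z) dA(z)`, with `dA` planar Lebesgue measure. -/
def skewFormComplex (s : ℝ) (f g : Polynomial ℝ) : ℂ :=
  -2 * Complex.I * ∫ z : ℂ,
    (((max 1 ‖z‖) ^ (-2 * s) : ℝ) : ℂ) * (starRingEnd ℂ) (Polynomial.aeval z f) *
      Polynomial.aeval z g * ((Real.sign z.im : ℝ) : ℂ)

/-- The skew-symmetric form `⟨f | g⟩ = ⟨f | g⟩_ℝ + ⟨f | g⟩_ℂ`. -/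
def skewForm (s : ℝ) (f g : Polynomial ℝ) : ℂ :=
  (skewFormReal s f g : ℂ) + skewFormComplex s f g

/-- The matrix `U = [⟨p_m | p_n⟩]`, `0 ≤ m, n < N`, of a sequence of polynomials. -/
def gram (s : ℝ) (p : ℕ → Polynomial ℝ) (N : ℕ) : Matrix (Fin N) (Fin N) ℂ :=
  Matrix.of fun m n => skewForm s (p m) (p n)

/-- The kernel for an even number `N` of roots:
`-2 max{1,|u|}^(-s) max{1,|v|}^(-s) ∑_{m,n} (U⁻¹)_{m,n} p_m(u) p_n(v)`. -/
def kernelEven (s : ℝ) (p : ℕ → Polynomial ℝ) (N : ℕ) (u v : ℂ) : ℂ :=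
  -2 * (weight s u : ℂ) * (weight s v : ℂ) *
    ∑ m : Fin N, ∑ n : Fin N,
      (gram s p N)⁻¹ m n * Polynomial.aeval u (p m) * Polynomial.aeval v (p n)

/-- The skew-orthonormal polynomial `π_{2n}`. -/
def piEven (n : ℕ) : Polynomial ℝ :=
  Polynomial.C (2 / Real.pi) * ∑ k ∈ Finset.range (n + 1),
    Polynomial.C (Real.Gamma ((k : ℝ) + 3 / 2) * Real.Gamma ((n : ℝ) - k + 1 / 2) /
      (Real.Gamma ((k : ℝ) + 1) * Real.Gamma ((n : ℝ) - k + 1))) * Polynomial.X ^ (2 * k)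

/-- The skew-orthonormal polynomial `π_{2n+1}`. -/
def piOdd (s : ℝ) (n : ℕ) : Polynomial ℝ :=
  Polynomial.C (-(1 / (2 * Real.pi))) * ∑ k ∈ Finset.range (n + 1),
    Polynomial.C ((s - (2 * (k : ℝ) + 2)) / (2 * s) *
      (Real.Gamma ((k : ℝ) + 3 / 2) * Real.Gamma ((n : ℝ) - k - 1 / 2) /
        (Real.Gamma ((k : ℝ) + 1) * Real.Gamma ((n : ℝ) - k + 1)))) * Polynomial.X ^ (2 * k + 1)

/-- The number `s_{2n}`, the integral over `ℝ` of the weighted polynomial `π_{2n}`. -/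
def lineIntegral (s : ℝ) (n : ℕ) : ℝ :=
  ∫ x : ℝ, (piEven n).eval x * (max 1 |x|) ^ (-s)

/-- The weighted polynomial `π_{2n}(z) max{1,|z|}^(-s)`. -/
def wPiEven (s : ℝ) (n : ℕ) (z : ℂ) : ℂ := Polynomial.aeval z (piEven n) * (weight s z : ℂ)

/-- The weighted polynomial `π_{2n+1}(z) max{1,|z|}^(-s)`. -/
def wPiOdd (s : ℝ) (n : ℕ) (z : ℂ) : ℂ := Polynomial.aeval z (piOdd s n) * (weight s z : ℂ)

/-- The kernel for an odd number `2J + 1` of roots. -/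
def kernelOdd (s : ℝ) (p : ℕ → Polynomial ℝ) (J : ℕ) (u v : ℂ) : ℂ :=
  kernelEven s p (2 * J) u v -
    2 * ∑ j ∈ Finset.range J, ((lineIntegral s j / lineIntegral s J : ℝ) : ℂ) *
      (wPiEven s J u * wPiOdd s j v - wPiEven s J v * wPiOdd s j u)

/-- The scalar kernel `ϰ_N(u, v)`: the (1,1)-entry of the matrix kernel of the root process. -/
def kernel (s : ℝ) (p : ℕ → Polynomial ℝ) (N : ℕ) (u v : ℂ) : ℂ :=
  if Even N then kernelEven s p N u v else kernelOdd s p (N / 2) u v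

/-- The exterior `{|z| > 1}` of the closed unit disk. -/
def exterior : Set ℂ := {z | 1 < ‖z‖}

/-- The branch of `√(u² - 1)` that is holomorphic off `[-1, 1]` and behaves like `u` at infinity:
for `|u| > 1` the number `1 - 1/u²` has positive real part, and the principal root is taken. -/
def sqrtOut (u : ℂ) : ℂ := u * (1 - 1 / u ^ 2) ^ (1 / 2 : ℂ)

end RealMahler

end

/-! ### Taylor coefficients of `(1 - x) ^ (∓1/2)`. -/

namespace RealMahler

open Filter Topology Finset

/-! Write `a_k`, `b_k` for the Taylor coefficients of `(1 - x) ^ (-1/2)` and `(1 - x) ^ (1/2)`. The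
Gamma quotients in the definitions are products of these: up to explicit factors, `π_{2n}` has
coefficients `a_k a_{n-k}` and `π_{2n+1}` has coefficients `a_k b_{n-k}`.

Algebra. On monomials of even degree `m` and odd degree `n`, the real and complex parts of the form
add up to `4 s / ((s - n - 1) (m + 1) (n - m))` (`moment_even_odd`): a Cauchy matrix scaled by rows
and columns. The explicit factors in `π_k` cancel the scaling, and skew-orthonormality becomes
`biorthogonality`, a consequence of the partial fraction expansion `sum_invSqrtCoeff_div` and of `(1
- x) ^ (-1/2) (1 - x) ^ (1/2) = 1`. The kernel does not depend on the polynomials `p_n`, so for even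
size it is twice the weighted antisymmetrized sum of `π_{2j}(u) π_{2j+1}(v)` (`kernelEven_eq`). The
same partial fractions evaluate the line integrals `s_{2j}`, whose ratios are finite products.

Analysis. Outside the unit disk only the top coefficients matter. With `j = J - (i + 1)`, and after
division by powers of `u` and `v` and by the leading coefficient of `π_{2J}`, the polynomials are
partial sums in `u⁻²`, `v⁻²` which converge to `(1 - u⁻²) ^ (-1/2)` times elementary factors. The
sum over `i` is dominated by a polynomial factor times a geometric one, so the limit may be taken
termwise. The constant `λ / π` comes from the Wallis product through the squared leading
coefficient. In the odd case the correction sum telescopes (`hasSum_telescope`), and exactly repairs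
the difference between the regimes `s - 2 J = d` and `s - 2 J = d + 1`, where `d = s - N`.

All limits are taken along an arbitrary filter with `u` and `v` moving. Convergence along `atTop ×ˢ
𝓝[S] w` together with continuity of the limit is locally uniform convergence, so no separate uniform
estimate is needed. The last two claims follow on multiplying by `(s - N) |uv| ^ (-(s - N))`. -/

/-- The Taylor coefficients of `(1 - x) ^ (-1/2)`. -/
noncomputable def invSqrtCoeff (n : ℕ) : ℝ := (n.centralBinom : ℝ) / 4 ^ n

/-- The Taylor coefficients of `(1 - x) ^ (1/2)`. -/
noncomputable def sqrtCoeff : ℕ → ℝ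
  | 0 => 1
  | n + 1 => -invSqrtCoeff n / (2 * (n + 1))

@[simp] lemma invSqrtCoeff_zero : invSqrtCoeff 0 = 1 := by simp [invSqrtCoeff]

@[simp] lemma sqrtCoeff_zero : sqrtCoeff 0 = 1 := rfl

lemma sqrtCoeff_succ (n : ℕ) : sqrtCoeff (n + 1) = -invSqrtCoeff n / (2 * (n + 1)) := rfl

lemma invSqrtCoeff_pos (n : ℕ) : 0 < invSqrtCoeff n := by
  unfold invSqrtCoeff
  have := n.centralBinom_pos
  positivity

lemma succ_mul_invSqrtCoeff_succ (n : ℕ) :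
    ((n : ℝ) + 1) * invSqrtCoeff (n + 1) = ((n : ℝ) + 1 / 2) * invSqrtCoeff n := by
  have h : ((n : ℝ) + 1) * ((n + 1).centralBinom : ℝ) = 2 * (2 * n + 1) * n.centralBinom := by
    exact_mod_cast n.succ_mul_centralBinom_succ
  unfold invSqrtCoeff
  rw [← mul_div_assoc, h, pow_succ]
  field_simp
  ring

lemma invSqrtCoeff_succ (n : ℕ) :
    invSqrtCoeff (n + 1) = ((n : ℝ) + 1 / 2) / (n + 1) * invSqrtCoeff n := by
  have := succ_mul_invSqrtCoeff_succ n
  field_simp at this ⊢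
  linarith

lemma invSqrtCoeff_le_one (n : ℕ) : invSqrtCoeff n ≤ 1 := by
  induction n with
  | zero => simp
  | succ n ih =>
    rw [invSqrtCoeff_succ]
    refine mul_le_one₀ ?_ (invSqrtCoeff_pos n).le ih
    rw [div_le_one (by positivity)]
    linarith

lemma abs_sqrtCoeff_le_one (n : ℕ) : |sqrtCoeff n| ≤ 1 := by
  cases n with
  | zero => simp
  | succ n =>
    have h1 := invSqrtCoeff_le_one n
    have h0 := invSqrtCoeff_pos n
    rw [sqrtCoeff_succ, abs_div, abs_neg, abs_of_pos h0, abs_of_pos (by positivity),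
      div_le_one (by positivity)]
    have : (0 : ℝ) ≤ n := n.cast_nonneg
    linarith

lemma sqrtCoeff_eq_sub (n : ℕ) :
    sqrtCoeff (n + 1) = invSqrtCoeff (n + 1) - invSqrtCoeff n := by
  rw [sqrtCoeff_succ, invSqrtCoeff_succ]
  field_simp
  ring

lemma mul_sqrtCoeff_succ (n : ℕ) :
    ((n : ℝ) + 1) * sqrtCoeff (n + 1) = ((n : ℝ) - 1 / 2) * sqrtCoeff n := by
  cases n with
  | zero => simp [sqrtCoeff_succ]; norm_num
  | succ n =>
    rw [sqrtCoeff_succ, sqrtCoeff_succ, invSqrtCoeff_succ]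
    push_cast
    field_simp
    ring

/-- The formal series satisfy `2 (1 - X) A' = A` and `2 (1 - X) B' = -B`, so `(A B)' = 0`; the
constant term of `A B` is `1`. -/
lemma sum_antidiagonal_coeff (n : ℕ) :
    ∑ q ∈ antidiagonal n, invSqrtCoeff q.1 * sqrtCoeff q.2 = if n = 0 then 1 else 0 := by
  let A : PowerSeries ℝ := PowerSeries.mk invSqrtCoeff
  let B : PowerSeries ℝ := PowerSeries.mk sqrtCoeff
  have hA : 2 * ((1 - PowerSeries.X) * PowerSeries.derivative ℝ A) = A := by
    ext n
    have h := succ_mul_invSqrtCoeff_succ n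
    cases n with
    | zero =>
      have h0 : PowerSeries.constantCoeff (PowerSeries.derivative ℝ A) = 1 / 2 := by
        rw [← PowerSeries.coeff_zero_eq_constantCoeff_apply, PowerSeries.coeff_derivative]
        simp [A, invSqrtCoeff_succ]
      simp [sub_mul, two_mul, h0]
      simp [A]
      norm_num
    | succ n =>
      push_cast at h
      simp [A, sub_mul, PowerSeries.coeff_derivative, PowerSeries.coeff_succ_X_mul, two_mul]
      linarith
  have hB : 2 * ((1 - PowerSeries.X) * PowerSeries.derivative ℝ B) = -B := by
    ext n
    have h := mul_sqrtCoeff_succ n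
    cases n with
    | zero =>
      have h0 : PowerSeries.constantCoeff (PowerSeries.derivative ℝ B) = -(1 / 2) := by
        rw [← PowerSeries.coeff_zero_eq_constantCoeff_apply, PowerSeries.coeff_derivative]
        simp [B, sqrtCoeff_succ]
        norm_num
      simp only [sub_mul, two_mul, h0, map_add, map_sub, map_mul, PowerSeries.coeff_zero_eq_constantCoeff, PowerSeries.constantCoeff_X, map_neg, one_mul, zero_mul, B, PowerSeries.constantCoeff_mk, sqrtCoeff_zero]
      norm_num
    | succ n =>
      push_cast at h
      simp [B, sub_mul, PowerSeries.coeff_derivative, PowerSeries.coeff_succ_X_mul, two_mul]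
      linarith
  have hX : (2 * (1 - PowerSeries.X) : PowerSeries ℝ) ≠ 0 := by
    intro h
    have := congrArg (PowerSeries.coeff 0) h
    simp [two_mul] at this
  have h1 : A * B = 1 := by
    refine PowerSeries.derivative.ext ?_ (by simp [A, B])
    apply mul_left_cancel₀ hX
    rw [Derivation.leibniz]
    simp only [smul_eq_mul, Derivation.map_one_eq_zero, mul_zero]
    linear_combination A * hB + B * hA
  have := congrArg (PowerSeries.coeff n) h1
  simpa [PowerSeries.coeff_mul, A, B, PowerSeries.coeff_one] using this

/-! ### Partial fractions and biorthogonality. -/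

/-- `∏ (z - j + 1/2) / (z - j)` over `1 ≤ j ≤ n`, divided by `z`. -/
noncomputable def halfRatio (n : ℕ) (z : ℝ) : ℝ :=
  z⁻¹ * ∏ j ∈ range n, (z - j - 1 / 2) / (z - j - 1)

lemma prod_erase_range_sub (n i : ℕ) (hi : i ≤ n) :
    ∏ j ∈ (range (n + 1)).erase i, ((i : ℝ) - j) = (i.factorial : ℝ) * ((-1) ^ (n - i) *
      (n - i).factorial) := by
  obtain ⟨m, rfl⟩ := Nat.exists_eq_add_of_le hi
  rw [Nat.add_sub_cancel_left]
  induction m with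
  | zero =>
    have : (range (i + 0 + 1)).erase i = range i := by ext; simp; omega
    rw [this]
    clear this hi
    simp only [pow_zero, Nat.factorial_zero, Nat.cast_one, mul_one]
    rw [← Finset.prod_range_reflect, ← Finset.prod_range_add_one_eq_factorial]
    push_cast
    refine Finset.prod_congr rfl fun j hj => ?_
    have := mem_range.1 hj
    rw [Nat.sub_sub, Nat.cast_sub (by omega)]
    push_cast; ring
  | succ m ih =>
    have : (range (i + (m + 1) + 1)).erase i = insert (i + m + 1) ((range (i + m + 1)).erase i) := by
      ext; simp; omega
    rw [this, Finset.prod_insert (by simp), ih (by omega), Nat.factorial_succ]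
    push_cast; ring

/-- The sign and factorials match those of the nodal derivative in `prod_erase_range_sub`, so that
the quotient of the two, a residue of the partial fraction expansion below, is `a_i a_{n-i}`. -/
lemma prod_range_half (n i : ℕ) (hi : i ≤ n) :
    ∏ j ∈ range n, ((i : ℝ) - j - 1 / 2) = (invSqrtCoeff i * i.factorial) * ((-1) ^ (n - i) *
      (invSqrtCoeff (n - i) * (n - i).factorial)) := by
  obtain ⟨m, rfl⟩ := Nat.exists_eq_add_of_le hi
  rw [Nat.add_sub_cancel_left]
  induction m with
  | zero =>
    simp only [add_zero, pow_zero, invSqrtCoeff_zero, Nat.factorial_zero, Nat.cast_one, mul_one]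
    clear hi
    induction i with
    | zero => simp
    | succ i ih =>
      rw [Finset.prod_range_succ', Nat.factorial_succ, invSqrtCoeff_succ]
      have : ∏ k ∈ range i, (((i + 1 : ℕ) : ℝ) - ((k + 1 : ℕ) : ℝ) - 1 / 2)
          = ∏ k ∈ range i, ((i : ℝ) - k - 1 / 2) :=
        Finset.prod_congr rfl fun k _ => by push_cast; ring
      rw [this, ih]
      push_cast
      field_simp
      ring
  | succ m ih =>
    rw [← add_assoc, Finset.prod_range_succ, ih (by omega), Nat.factorial_succ, invSqrtCoeff_succ]
    push_cast
    field_simp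
    ring

/-- A terminating Saalschütz summation. -/
lemma sum_invSqrtCoeff_div (n : ℕ) (z : ℝ) (hz : ∀ i ∈ range (n + 1), z ≠ (i : ℝ)) :
    ∑ i ∈ range (n + 1), invSqrtCoeff i * invSqrtCoeff (n - i) / (z - i) = halfRatio n z := by
  -- `Q` has degree `n` and there are `n + 1` nodes `0, …, n`, so `Q` is its own interpolant. The
  -- barycentric formula at `z`, divided by the nodal polynomial, is the partial fraction expansion
  -- of `Q(z) / ∏ (z - j)`.
  let Q : Polynomial ℝ := ∏ j ∈ range n, (Polynomial.X - Polynomial.C ((j : ℝ) + 1 / 2))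
  have hQ : ∀ x : ℝ, Q.eval x = ∏ j ∈ range n, (x - j - 1 / 2) := fun x => by
    simp [Q, Polynomial.eval_prod, sub_sub]
  have hinj : Set.InjOn (fun j : ℕ => (j : ℝ)) (range (n + 1)) := fun _ _ _ _ h =>
    Nat.cast_injective h
  have hdeg : Q.degree < #(range (n + 1)) := by
    rw [Polynomial.degree_prod]
    simp only [Polynomial.degree_X_sub_C, card_range, sum_const, nsmul_eq_mul, mul_one]
    exact_mod_cast Nat.lt_succ_self n
  have h1 := Lagrange.eq_interpolate hinj hdeg
  have h2 := Lagrange.eval_interpolate_not_at_node (v := fun j : ℕ => (j : ℝ)) (s := range (n + 1))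
    (fun i => Q.eval (i : ℝ)) hz
  rw [← h1, Lagrange.eval_nodal, Finset.prod_range_succ', hQ] at h2
  have hsum : ∑ i ∈ range (n + 1), Lagrange.nodalWeight (range (n + 1)) (fun j : ℕ => (j : ℝ)) i *
        (z - i)⁻¹ * Q.eval (i : ℝ) =
      ∑ i ∈ range (n + 1), invSqrtCoeff i * invSqrtCoeff (n - i) / (z - i) := by
    refine Finset.sum_congr rfl fun i hi => ?_
    have hin : i ≤ n := Nat.lt_succ_iff.1 (mem_range.1 hi)
    rw [hQ, prod_range_half n i hin, Lagrange.nodalWeight, Finset.prod_inv_distrib,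
      prod_erase_range_sub n i hin]
    have h3 := sub_ne_zero.2 (hz i hi)
    have h4 : ((-1 : ℝ)) ^ (n - i) ≠ 0 := pow_ne_zero _ (by norm_num)
    have h5 : (i.factorial : ℝ) ≠ 0 := by positivity
    have h6 : ((n - i).factorial : ℝ) ≠ 0 := by positivity
    field_simp
  rw [hsum] at h2
  have hz0 : z - ((0 : ℕ) : ℝ) ≠ 0 := sub_ne_zero.2 (hz 0 (by simp))
  have hp : ∏ k ∈ range n, (z - ((k + 1 : ℕ) : ℝ)) ≠ 0 := Finset.prod_ne_zero_iff.2 fun k hk =>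
    sub_ne_zero.2 (hz (k + 1) (by simpa using hk))
  have h3 : ∏ j ∈ range n, (z - j - 1) = ∏ k ∈ range n, (z - ((k + 1 : ℕ) : ℝ)) :=
    Finset.prod_congr rfl fun k _ => by push_cast; ring
  rw [halfRatio, Finset.prod_div_distrib, h2, h3]
  simp only [Nat.cast_zero, sub_zero] at hz0 ⊢
  field_simp

/-- At `z = k + 1/2` the numerators are `k - j`. One of them vanishes if `k < n`; otherwise each
factor `(k - j) / (k - j - 1/2)` inverts one step of the recursion for `a`, lowering the index by
one. -/
lemma halfRatio_add_half (n k : ℕ) :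
    ((k : ℝ) + 1 / 2) * invSqrtCoeff k * halfRatio n ((k : ℝ) + 1 / 2) =
      if n ≤ k then invSqrtCoeff (k - n) else 0 := by
  unfold halfRatio
  have h0 : (k : ℝ) + 1 / 2 ≠ 0 := by positivity
  split_ifs with h
  · induction n with
    | zero => simp only [range_zero, prod_empty, Nat.sub_zero]; field_simp
    | succ n ih =>
      rw [Finset.prod_range_succ, ← mul_assoc, ← mul_assoc]
      rw [← mul_assoc] at ih
      rw [ih (by omega)]
      obtain ⟨m, rfl⟩ := Nat.exists_eq_add_of_le h
      have e1 : n + 1 + m - n = m + 1 := by omega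
      have e2 : n + 1 + m - (n + 1) = m := by omega
      rw [e1, e2, invSqrtCoeff_succ]
      have h3 : ((n + 1 + m : ℕ) : ℝ) + 1 / 2 - n - 1 ≠ 0 := by push_cast; ring_nf; positivity
      have h4 : ((n + 1 + m : ℕ) : ℝ) + 1 / 2 - n - 1 / 2 = m + 1 := by push_cast; ring
      have h5 : ((n + 1 + m : ℕ) : ℝ) + 1 / 2 - n - 1 = m + 1 / 2 := by push_cast; ring
      rw [h4, h5]
      have : (m : ℝ) + 1 / 2 ≠ 0 := by positivity
      field_simp
  · rw [Finset.prod_eq_zero (i := k) (by simpa using h) (by simp)]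
    simp

/-- Only the terms with `n ≤ k` survive, and they form the convolution of `a` and `b` at `n' - n`.
-/
lemma sum_halfRatio_sqrtCoeff (n n' : ℕ) :
    ∑ k ∈ range (n' + 1), ((k : ℝ) + 1 / 2) * invSqrtCoeff k * halfRatio n ((k : ℝ) + 1 / 2) *
      sqrtCoeff (n' - k) = if n = n' then 1 else 0 := by
  simp only [halfRatio_add_half]
  rcases lt_or_ge n' n with h | h
  · rw [if_neg (by omega)]
    refine Finset.sum_eq_zero fun k hk => ?_
    rw [if_neg (by have := mem_range.1 hk; omega), zero_mul]
  · obtain ⟨m, rfl⟩ := Nat.exists_eq_add_of_le h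
    rw [add_assoc, Finset.sum_range_add, Finset.sum_eq_zero, zero_add]
    · have := sum_antidiagonal_coeff m
      rw [Finset.Nat.sum_antidiagonal_eq_sum_range_succ
        (f := fun i j => invSqrtCoeff i * sqrtCoeff j)] at this
      simp only [left_eq_add, ← this]
      refine Finset.sum_congr rfl fun k _ => ?_
      rw [if_pos (by omega)]
      congr 2 <;> omega
    · intro k hk
      rw [if_neg (by have := mem_range.1 hk; omega), zero_mul]

/-- The biorthogonality of the coefficient arrays of the skew-orthonormal polynomials. -/
lemma biorthogonality (n n' : ℕ) :
    ∑ i ∈ range (n + 1), ∑ k ∈ range (n' + 1),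
      invSqrtCoeff i * invSqrtCoeff (n - i) *
        ((2 * (k : ℝ) + 1) * invSqrtCoeff k * sqrtCoeff (n' - k)) / (2 * k + 1 - 2 * i) =
      if n = n' then 1 else 0 := by
  -- Since `2 k + 1 - 2 i = 2 (z - i)` with `z = k + 1/2`, the sum over `i` is the partial fraction
  -- expansion at a half-integer, where no denominator vanishes.
  rw [← sum_halfRatio_sqrtCoeff, Finset.sum_comm]
  refine Finset.sum_congr rfl fun k _ => ?_
  have hne : ∀ i : ℕ, (k : ℝ) + 1 / 2 - i ≠ 0 := fun i h => by
    have h2 : (2 * k + 1 : ℝ) = 2 * i := by linarith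
    have h3 : 2 * k + 1 = 2 * i := by exact_mod_cast h2
    omega
  rw [← sum_invSqrtCoeff_div n _ (fun i _ => sub_ne_zero.1 (hne i)), Finset.mul_sum,
    Finset.sum_mul]
  refine Finset.sum_congr rfl fun i _ => ?_
  have h1 := hne i
  have h2 : (2 * k + 1 - 2 * i : ℝ) ≠ 0 := fun h => h1 (by linarith)
  field_simp

/-! ### The Gamma quotients in terms of Taylor coefficients. -/

lemma gamma_add_half (k : ℕ) :
    Real.Gamma ((k : ℝ) + 1 / 2) = √Real.pi * invSqrtCoeff k * k.factorial := by
  induction k with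
  | zero => rw [Nat.cast_zero, zero_add, Real.Gamma_one_half_eq]; simp
  | succ k ih =>
    have : ((k + 1 : ℕ) : ℝ) + 1 / 2 = ((k : ℝ) + 1 / 2) + 1 := by push_cast; ring
    rw [this, Real.Gamma_add_one (by positivity), ih, invSqrtCoeff_succ, Nat.factorial_succ]
    push_cast
    field_simp

/-- The factor `-2` comes from `Γ(-1/2) = -2 √π`; its sign cancels the minus sign in the definition
of `π_{2n+1}`. -/
lemma gamma_sub_half (k : ℕ) :
    Real.Gamma ((k : ℝ) - 1 / 2) = -2 * √Real.pi * sqrtCoeff k * k.factorial := by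
  induction k with
  | zero =>
    have := Real.Gamma_add_one (s := -(1 / 2 : ℝ)) (by norm_num)
    rw [show (-(1 / 2 : ℝ)) + 1 = 1 / 2 by norm_num, Real.Gamma_one_half_eq] at this
    simp only [Nat.cast_zero, zero_sub, sqrtCoeff_zero, Nat.factorial_zero, Nat.cast_one, mul_one]
    linarith
  | succ k ih =>
    have : ((k + 1 : ℕ) : ℝ) - 1 / 2 = ((k : ℝ) - 1 / 2) + 1 := by push_cast; ring
    have hne : (k : ℝ) - 1 / 2 ≠ 0 := fun h => by
      have h2 : (2 * k : ℝ) = 1 := by linarith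
      have h3 : 2 * k = 1 := by exact_mod_cast h2
      omega
    have h := mul_sqrtCoeff_succ k
    rw [this, Real.Gamma_add_one hne, ih, Nat.factorial_succ]
    push_cast
    linear_combination (2 * √Real.pi * k.factorial) * h

lemma gamma_ratio_even (n k : ℕ) (hk : k ≤ n) :
    2 / Real.pi * (Real.Gamma ((k : ℝ) + 3 / 2) * Real.Gamma ((n : ℝ) - k + 1 / 2) /
      (Real.Gamma ((k : ℝ) + 1) * Real.Gamma ((n : ℝ) - k + 1))) =
      (2 * (k : ℝ) + 1) * invSqrtCoeff k * invSqrtCoeff (n - k) := by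
  rw [← Nat.cast_sub hk, show (k : ℝ) + 3 / 2 = (k + 1 / 2) + 1 by ring,
    Real.Gamma_add_one (by positivity), gamma_add_half, gamma_add_half,
    Real.Gamma_nat_eq_factorial, Real.Gamma_nat_eq_factorial]
  have := Real.pi_pos
  have h := Real.mul_self_sqrt this.le
  have h5 : (k.factorial : ℝ) ≠ 0 := by positivity
  have h6 : ((n - k).factorial : ℝ) ≠ 0 := by positivity
  field_simp
  rw [Real.sq_sqrt this.le]

lemma gamma_ratio_odd (s : ℝ) (hs : s ≠ 0) (n k : ℕ) (hk : k ≤ n) :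
    -(1 / (2 * Real.pi)) * ((s - (2 * (k : ℝ) + 2)) / (2 * s) *
      (Real.Gamma ((k : ℝ) + 3 / 2) * Real.Gamma ((n : ℝ) - k - 1 / 2) /
        (Real.Gamma ((k : ℝ) + 1) * Real.Gamma ((n : ℝ) - k + 1)))) =
      (s - 2 * k - 2) / (4 * s) * ((2 * (k : ℝ) + 1) * invSqrtCoeff k * sqrtCoeff (n - k)) := by
  rw [← Nat.cast_sub hk, show (k : ℝ) + 3 / 2 = (k + 1 / 2) + 1 by ring,
    Real.Gamma_add_one (by positivity), gamma_add_half, gamma_sub_half,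
    Real.Gamma_nat_eq_factorial, Real.Gamma_nat_eq_factorial]
  have := Real.pi_pos
  have h5 : (k.factorial : ℝ) ≠ 0 := by positivity
  have h6 : ((n - k).factorial : ℝ) ≠ 0 := by positivity
  field_simp
  rw [Real.sq_sqrt this.le]
  ring

lemma piEven_eq (n : ℕ) : piEven n = ∑ k ∈ range (n + 1),
    Polynomial.C ((2 * (k : ℝ) + 1) * invSqrtCoeff k * invSqrtCoeff (n - k)) *
      Polynomial.X ^ (2 * k) := by
  rw [piEven, Finset.mul_sum]
  refine Finset.sum_congr rfl fun k hk => ?_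
  rw [← mul_assoc, ← Polynomial.C_mul,
    gamma_ratio_even n k (Nat.lt_succ_iff.1 (mem_range.1 hk))]

lemma piOdd_eq (s : ℝ) (hs : s ≠ 0) (n : ℕ) : piOdd s n = ∑ k ∈ range (n + 1),
    Polynomial.C ((s - 2 * k - 2) / (4 * s) *
      ((2 * (k : ℝ) + 1) * invSqrtCoeff k * sqrtCoeff (n - k))) *
      Polynomial.X ^ (2 * k + 1) := by
  rw [piOdd, Finset.mul_sum]
  refine Finset.sum_congr rfl fun k hk => ?_
  rw [← mul_assoc, ← Polynomial.C_mul,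
    gamma_ratio_odd s hs n k (Nat.lt_succ_iff.1 (mem_range.1 hk))]

end RealMahler

/-! ### The real part of the form on monomials. -/

namespace RealMahler

open Filter Topology Finset MeasureTheory Set

lemma continuous_max_one_norm_rpow {E : Type*} [NormedAddCommGroup E] (r : ℝ) :
    Continuous fun x : E => (max 1 ‖x‖) ^ r :=
  (continuous_const.max continuous_norm).rpow_const fun _ =>
    Or.inl (zero_lt_one.trans_le (le_max_left _ _)).ne'

lemma integrable_max_one_norm_rpow {E : Type*} [NormedAddCommGroup E] [NormedSpace ℝ E]
    [FiniteDimensional ℝ E] [MeasurableSpace E] [BorelSpace E] (μ : Measure E)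
    [μ.IsAddHaarMeasure] {r : ℝ} (hr : (Module.finrank ℝ E : ℝ) < r) :
    Integrable (fun x : E => (max 1 ‖x‖) ^ (-r)) μ := by
  have h0 : 0 < r := lt_of_le_of_lt (Nat.cast_nonneg _) hr
  refine ((integrable_one_add_norm (μ := μ) hr).const_mul (2 ^ r)).mono'
    (continuous_max_one_norm_rpow _).aestronglyMeasurable (Eventually.of_forall fun x => ?_)
  have h1 : 0 < 1 + ‖x‖ := by positivity
  have h2 : (1 + ‖x‖) / 2 ≤ max 1 ‖x‖ := by
    have := le_max_left 1 ‖x‖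
    have := le_max_right 1 ‖x‖
    linarith
  rw [Real.norm_of_nonneg (by positivity)]
  calc (max 1 ‖x‖) ^ (-r) ≤ ((1 + ‖x‖) / 2) ^ (-r) :=
        Real.rpow_le_rpow_of_nonpos (by positivity) h2 (by linarith)
    _ = 2 ^ r * (1 + ‖x‖) ^ (-r) := by
        rw [Real.div_rpow h1.le (by norm_num), Real.rpow_neg (by norm_num : (0 : ℝ) ≤ 2)]
        field_simp

/-- The weighted monomial `x ^ n max {1, |x|} ^ (-s)` on the line. -/
noncomputable def wMonomial (s : ℝ) (n : ℕ) (x : ℝ) : ℝ := (max 1 |x|) ^ (-s) * x ^ n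

lemma continuous_wMonomial (s : ℝ) (n : ℕ) : Continuous (wMonomial s n) :=
  (continuous_max_one_norm_rpow (E := ℝ) (-s)).mul (continuous_pow n)

lemma max_one_rpow_mul_pow_le (t r : ℝ) (ht : 0 ≤ t) (n : ℕ) :
    (max 1 t) ^ (-r) * t ^ n ≤ (max 1 t) ^ (-(r - n)) := by
  have h : 0 < max 1 t := zero_lt_one.trans_le (le_max_left _ _)
  rw [neg_sub, sub_eq_add_neg, add_comm, Real.rpow_add h, Real.rpow_natCast]
  gcongr
  exact le_max_right _ _

lemma integrable_wMonomial {s : ℝ} {n : ℕ} (h : (n : ℝ) + 1 < s) : Integrable (wMonomial s n) := by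
  refine (integrable_max_one_norm_rpow (E := ℝ) volume (r := s - n) (by simp; linarith)).mono'
    (continuous_wMonomial s n).aestronglyMeasurable (Eventually.of_forall fun x => ?_)
  rw [wMonomial, norm_mul, norm_pow, Real.norm_of_nonneg (by positivity)]
  exact max_one_rpow_mul_pow_le _ _ (abs_nonneg x) n

lemma wMonomial_neg (s : ℝ) (n : ℕ) (x : ℝ) : wMonomial s n (-x) = (-1) ^ n * wMonomial s n x := by
  rw [wMonomial, wMonomial, abs_neg, neg_pow]
  ring

lemma wMonomial_of_one_le (s : ℝ) (n : ℕ) {x : ℝ} (hx : 1 ≤ x) : wMonomial s n x = x ^ (n - s) := by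
  have h0 : 0 < x := by linarith
  rw [wMonomial, abs_of_pos h0, max_eq_right hx, sub_eq_add_neg, add_comm, Real.rpow_add h0,
    Real.rpow_natCast]

lemma wMonomial_of_le_one (s : ℝ) (n : ℕ) {x : ℝ} (h0 : 0 ≤ x) (hx : x ≤ 1) :
    wMonomial s n x = x ^ n := by
  rw [wMonomial, abs_of_nonneg h0, max_eq_left hx, Real.one_rpow, one_mul]

lemma integral_Ioi_wMonomial_of_one_le {s : ℝ} {n : ℕ} (h : (n : ℝ) + 1 < s) {x : ℝ} (hx : 1 ≤ x) :
    ∫ y in Ioi x, wMonomial s n y = x ^ (n + 1 - s) / (s - n - 1) := by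
  have h1 : ∫ y in Ioi x, wMonomial s n y = ∫ y in Ioi x, y ^ ((n : ℝ) - s) :=
    setIntegral_congr_fun measurableSet_Ioi fun y hy => wMonomial_of_one_le s n (hx.trans hy.le)
  rw [h1, integral_Ioi_rpow_of_lt (by linarith) (by linarith)]
  rw [neg_div, ← div_neg]
  congr 1 <;> ring_nf

lemma integral_Ioi_wMonomial_of_le_one {s : ℝ} {n : ℕ} (h : (n : ℝ) + 1 < s) {x : ℝ} (h0 : 0 ≤ x)
    (hx : x ≤ 1) :
    ∫ y in Ioi x, wMonomial s n y = 1 / (s - n - 1) + (1 - x ^ (n + 1)) / (n + 1) := by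
  have hint := integrable_wMonomial h
  rw [← Ioc_union_Ioi_eq_Ioi hx, setIntegral_union (Ioc_disjoint_Ioi le_rfl) measurableSet_Ioi
    hint.integrableOn hint.integrableOn, integral_Ioi_wMonomial_of_one_le h le_rfl, Real.one_rpow]
  have h1 : ∫ y in Ioc x 1, wMonomial s n y = ∫ y in Ioc x 1, y ^ n :=
    setIntegral_congr_fun measurableSet_Ioc fun y hy =>
      wMonomial_of_le_one s n (h0.trans hy.1.le) hy.2
  rw [h1, ← intervalIntegral.integral_of_le hx, integral_pow, one_pow, add_comm]

lemma integral_Ioi_zero_wMonomial {s : ℝ} {n : ℕ} (h : (n : ℝ) + 1 < s) :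
    ∫ y in Ioi 0, wMonomial s n y = s / ((n + 1) * (s - n - 1)) := by
  rw [integral_Ioi_wMonomial_of_le_one h le_rfl zero_le_one]
  have : s - n - 1 ≠ 0 := by linarith
  rw [zero_pow (by omega)]
  field_simp
  ring

lemma measurable_sign : Measurable Real.sign := by
  unfold Real.sign
  exact Measurable.ite measurableSet_Iio measurable_const
    (Measurable.ite measurableSet_Ioi measurable_const measurable_const)

lemma abs_sign_le_one (x : ℝ) : |Real.sign x| ≤ 1 := by
  rcases Real.sign_apply_eq x with h | h | h <;> rw [h] <;> norm_num

lemma integrable_mul_sign {α : Type*} [MeasurableSpace α] {μ : Measure α} {f g : α → ℝ}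
    (hf : Integrable f μ) (hg : Measurable g) : Integrable (fun x => f x * Real.sign (g x)) μ :=
  hf.mul_bdd (c := 1) (measurable_sign.comp hg).aestronglyMeasurable
    (Eventually.of_forall fun _ => abs_sign_le_one _)

/-- The integral of a weighted monomial against `sgn (y - x)`. -/
noncomputable def signTransform (s : ℝ) (n : ℕ) (x : ℝ) : ℝ :=
  ∫ y : ℝ, wMonomial s n y * Real.sign (y - x)

lemma signTransform_neg (s : ℝ) (n : ℕ) (x : ℝ) :
    signTransform s n (-x) = (-1) ^ (n + 1) * signTransform s n x := by
  unfold signTransform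
  rw [← integral_neg_eq_self, ← integral_const_mul]
  refine integral_congr_ae (Eventually.of_forall fun y => ?_)
  simp only
  rw [wMonomial_neg, show -y - -x = -(y - x) by ring, Real.sign_neg]
  ring

lemma measurable_signTransform (s : ℝ) (n : ℕ) : StronglyMeasurable (signTransform s n) := by
  unfold signTransform
  apply StronglyMeasurable.integral_prod_right (f := fun x y => wMonomial s n y * Real.sign (y - x))
  apply Measurable.stronglyMeasurable
  exact ((continuous_wMonomial s n).measurable.comp measurable_snd).mul
    (measurable_sign.comp (measurable_snd.sub measurable_fst))

lemma integrable_mul_signTransform {s : ℝ} {m n : ℕ} (hm : (m : ℝ) + 1 < s) (hn : (n : ℝ) + 1 < s) :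
    Integrable fun x => wMonomial s m x * signTransform s n x := by
  refine (integrable_wMonomial hm).mul_bdd (c := ∫ y, |wMonomial s n y|)
    (measurable_signTransform s n).aestronglyMeasurable (Eventually.of_forall fun x => ?_)
  refine (norm_integral_le_integral_norm _).trans (integral_mono
    (integrable_mul_sign (integrable_wMonomial hn) (by fun_prop)).norm
    (integrable_wMonomial hn).abs fun y => ?_)
  simp only [norm_mul, Real.norm_eq_abs]
  exact mul_le_of_le_one_right (abs_nonneg _) (abs_sign_le_one _)

/-- The real part of the skew form on monomials. -/
noncomputable def realMoment (s : ℝ) (m n : ℕ) : ℝ :=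
  ∫ x : ℝ, wMonomial s m x * signTransform s n x

lemma eval_mul_weight (s : ℝ) (f : Polynomial ℝ) {M : ℕ} (hf : f.natDegree < M) (x : ℝ) :
    (max 1 |x|) ^ (-s) * f.eval x = ∑ m ∈ range M, f.coeff m * wMonomial s m x := by
  rw [Polynomial.eval_eq_sum_range' hf, Finset.mul_sum]
  refine Finset.sum_congr rfl fun m _ => ?_
  rw [wMonomial]
  ring

lemma skewFormReal_eq_sum {s : ℝ} {M : ℕ} (hM : (M : ℝ) < s) (f g : Polynomial ℝ)
    (hf : f.natDegree < M) (hg : g.natDegree < M) :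
    skewFormReal s f g =
      ∑ m ∈ range M, ∑ n ∈ range M, f.coeff m * g.coeff n * realMoment s m n := by
  have hlt : ∀ m ∈ range M, (m : ℝ) + 1 < s := fun m hm => by
    have : m + 1 ≤ M := mem_range.1 hm
    have : ((m : ℝ) + 1) ≤ M := by exact_mod_cast this
    linarith
  have h1 : ∀ x, ∫ y : ℝ, (max 1 |x|) ^ (-s) * (max 1 |y|) ^ (-s) * f.eval x * g.eval y *
      Real.sign (y - x) = ∑ m ∈ range M, ∑ n ∈ range M,
        f.coeff m * g.coeff n * (wMonomial s m x * signTransform s n x) := by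
    intro x
    calc _ = ∫ y : ℝ, ∑ n ∈ range M, (((max 1 |x|) ^ (-s) * f.eval x) * g.coeff n) *
          (wMonomial s n y * Real.sign (y - x)) := by
            congr 1
            ext y
            rw [show (max 1 |x|) ^ (-s) * (max 1 |y|) ^ (-s) * f.eval x * g.eval y *
              Real.sign (y - x) = ((max 1 |x|) ^ (-s) * f.eval x) * ((max 1 |y|) ^ (-s) *
                g.eval y) * Real.sign (y - x) by ring, eval_mul_weight s g hg y, Finset.mul_sum,
              Finset.sum_mul]
            exact Finset.sum_congr rfl fun _ _ => by ring
      _ = ∑ n ∈ range M, (((max 1 |x|) ^ (-s) * f.eval x) * g.coeff n) * signTransform s n x := by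
            rw [integral_finsetSum]
            · simp_rw [integral_const_mul]
              rfl
            · intro n hn
              exact (integrable_mul_sign (integrable_wMonomial (hlt n hn))
                (by fun_prop)).const_mul _
      _ = _ := by
            rw [eval_mul_weight s f hf x, Finset.sum_comm]
            refine Finset.sum_congr rfl fun n _ => ?_
            rw [Finset.sum_mul, Finset.sum_mul]
            exact Finset.sum_congr rfl fun _ _ => by ring
  unfold skewFormReal
  simp_rw [h1]
  rw [integral_finsetSum]
  · refine Finset.sum_congr rfl fun m hm => ?_
    rw [integral_finsetSum]
    · refine Finset.sum_congr rfl fun n hn => ?_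
      rw [integral_const_mul]
      rfl
    · intro n hn
      exact (integrable_mul_signTransform (hlt m hm) (hlt n hn)).const_mul _
  · intro m hm
    exact integrable_finsetSum _ fun n hn =>
      (integrable_mul_signTransform (hlt m hm) (hlt n hn)).const_mul _

/-- The reflection `x ↦ -x` multiplies the integrand by `(-1) ^ (m + n + 1)`. -/
lemma realMoment_eq_zero {s : ℝ} {m n : ℕ} (h : Even (m + n)) : realMoment s m n = 0 := by
  have h1 : realMoment s m n = -realMoment s m n := by
    conv_lhs => rw [realMoment, ← integral_neg_eq_self]
    rw [realMoment, ← integral_neg]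
    refine integral_congr_ae (Eventually.of_forall fun x => ?_)
    simp only
    rw [wMonomial_neg, signTransform_neg]
    have : (-1 : ℝ) ^ m * (-1) ^ (n + 1) = -1 := by
      rw [← pow_add, ← add_assoc, h.add_one.neg_one_pow]
    linear_combination (wMonomial s m x * signTransform s n x) * this
  linarith

lemma realMoment_swap {s : ℝ} {m n : ℕ} (hm : (m : ℝ) + 1 < s) (hn : (n : ℝ) + 1 < s) :
    realMoment s m n = -realMoment s n m := by
  have hint : Integrable (fun z : ℝ × ℝ => wMonomial s m z.1 * wMonomial s n z.2 *
      Real.sign (z.2 - z.1)) (volume.prod volume) :=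
    integrable_mul_sign ((integrable_wMonomial hm).mul_prod (integrable_wMonomial hn))
      (by fun_prop)
  have h1 : realMoment s m n = ∫ x : ℝ, ∫ y : ℝ, wMonomial s m x * wMonomial s n y *
      Real.sign (y - x) := by
    simp_rw [realMoment, signTransform, ← integral_const_mul, mul_assoc]
  rw [h1, integral_integral_swap hint, realMoment, ← integral_neg]
  congr 1
  ext y
  rw [signTransform, ← integral_const_mul, ← integral_neg]
  congr 1
  ext x
  rw [← neg_sub x y, Real.sign_neg]
  ring

/-- For odd `n` the transform is even in `x`, so it may be averaged over `x` and `-x`. The averaged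
integrand is even in `y`, and for `y > 0` the sum `sgn (y - x) + sgn (y + x)` is twice the indicator
of `y > x`, up to the null set `y = x`. -/
lemma signTransform_of_odd {s : ℝ} {n : ℕ} (hn : Odd n) (h : (n : ℝ) + 1 < s) {x : ℝ}
    (hx : 0 ≤ x) : signTransform s n x = 2 * ∫ y in Ioi x, wMonomial s n y := by
  have hi := integrable_wMonomial h
  have i1 := integrable_mul_sign hi (g := fun y => y - x) (by fun_prop)
  have i2 := integrable_mul_sign hi (g := fun y => y + x) (by fun_prop)
  have h1 : signTransform s n x = ∫ y, wMonomial s n y * Real.sign (y + x) := by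
    have := signTransform_neg s n (-x)
    rw [neg_neg, hn.add_one.neg_one_pow, one_mul] at this
    rw [this]
    simp [signTransform]
  have h2 : 2 * signTransform s n x =
      ∫ y, wMonomial s n y * Real.sign (y - x) + wMonomial s n y * Real.sign (y + x) := by
    rw [integral_add i1 i2, two_mul]
    nth_rw 2 [h1]
    rfl
  have h3 : ∀ y, wMonomial s n y * Real.sign (y - x) + wMonomial s n y * Real.sign (y + x) =
      (fun t => wMonomial s n t * Real.sign (t - x) + wMonomial s n t * Real.sign (t + x)) |y| := by
    intro y
    rcases abs_choice y with hy | hy <;> simp only [hy]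
    rw [wMonomial_neg, hn.neg_one_pow, show -y - x = -(y + x) by ring,
      show -y + x = -(y - x) by ring, Real.sign_neg, Real.sign_neg]
    ring
  rw [integral_congr_ae (Eventually.of_forall h3), integral_comp_abs (f := fun t =>
    wMonomial s n t * Real.sign (t - x) + wMonomial s n t * Real.sign (t + x))] at h2
  have h4 : ∫ t in Ioi (0 : ℝ), (wMonomial s n t * Real.sign (t - x) +
      wMonomial s n t * Real.sign (t + x)) = ∫ t in Ioi (0 : ℝ),
        (Ioi x).indicator (fun t => 2 * wMonomial s n t) t := by
    refine setIntegral_congr_ae measurableSet_Ioi ?_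
    have : ∀ᵐ t : ℝ, t ≠ x := by simp [ae_iff, measure_singleton]
    filter_upwards [this] with t ht ht0
    have ht0 : 0 < t := ht0
    rw [Real.sign_of_pos (show 0 < t + x by linarith)]
    rcases lt_or_gt_of_ne ht with h | h
    · rw [Real.sign_of_neg (by linarith), indicator_of_notMem (by simpa using h.le)]
      ring
    · rw [Real.sign_of_pos (by linarith), indicator_of_mem (by simpa using h)]
      ring
  rw [h4, setIntegral_indicator measurableSet_Ioi, Ioi_inter_Ioi, max_eq_right hx,
    integral_const_mul] at h2
  linarith

/-- The integrand is even, so half the line suffices, and it is a combination of powers on each side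
of `1`, where the weight switches. Parity and antisymmetry reduce the other moments to this one. -/
lemma realMoment_even_odd {s : ℝ} {m n : ℕ} (hm : (m : ℝ) + 1 < s) (hn : (n : ℝ) + 1 < s)
    (em : Even m) (on : Odd n) :
    realMoment s m n = 4 * (1 / ((s - n - 1) * (m + 1)) + 1 / ((m + 1) * (m + n + 2)) +
      1 / ((s - n - 1) * (2 * s - m - n - 2))) := by
  have hint := integrable_mul_signTransform hm hn
  have h1 : realMoment s m n = 2 * ∫ x in Ioi (0 : ℝ), wMonomial s m x * signTransform s n x := by
    rw [realMoment, ← integral_comp_abs (f := fun x => wMonomial s m x * signTransform s n x)]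
    refine integral_congr_ae (Eventually.of_forall fun x => ?_)
    rcases abs_choice x with hx | hx <;> simp only [hx]
    rw [wMonomial_neg, signTransform_neg, em.neg_one_pow, on.add_one.neg_one_pow, one_mul, one_mul]
  rw [h1, ← Ioc_union_Ioi_eq_Ioi zero_le_one, setIntegral_union (Ioc_disjoint_Ioi le_rfl)
    measurableSet_Ioi hint.integrableOn hint.integrableOn]
  have hb : s - n - 1 ≠ 0 := by linarith
  have h2 : ∫ x in Ioc (0 : ℝ) 1, wMonomial s m x * signTransform s n x =
      2 * ((1 / (s - n - 1) + 1 / (n + 1)) / (m + 1) - 1 / ((n + 1) * (m + n + 2))) := by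
    have : ∫ x in Ioc (0 : ℝ) 1, wMonomial s m x * signTransform s n x =
        ∫ x in Ioc (0 : ℝ) 1, (2 * (1 / (s - n - 1) + 1 / (n + 1)) * x ^ m -
          2 / (n + 1) * x ^ (m + n + 1)) := by
      refine setIntegral_congr_fun measurableSet_Ioc fun x hx => ?_
      rw [wMonomial_of_le_one s m hx.1.le hx.2, signTransform_of_odd on hn hx.1.le,
        integral_Ioi_wMonomial_of_le_one hn hx.1.le hx.2]
      ring
    rw [this, ← intervalIntegral.integral_of_le zero_le_one, intervalIntegral.integral_sub,
      intervalIntegral.integral_const_mul, intervalIntegral.integral_const_mul, integral_pow,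
      integral_pow]
    · simp only [one_pow, zero_pow (Nat.succ_ne_zero _), sub_zero]
      push_cast
      field_simp
      ring
    · exact (Continuous.intervalIntegrable (by fun_prop) _ _)
    · exact (Continuous.intervalIntegrable (by fun_prop) _ _)
  have h3 : ∫ x in Ioi (1 : ℝ), wMonomial s m x * signTransform s n x =
      2 / ((s - n - 1) * (2 * s - m - n - 2)) := by
    have : ∫ x in Ioi (1 : ℝ), wMonomial s m x * signTransform s n x =
        ∫ x in Ioi (1 : ℝ), 2 / (s - n - 1) * x ^ (m + n + 1 - 2 * s) := by
      refine setIntegral_congr_fun measurableSet_Ioi fun x hx => ?_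
      have hx : 1 < x := hx
      rw [wMonomial_of_one_le s m hx.le, signTransform_of_odd on hn (by linarith),
        integral_Ioi_wMonomial_of_one_le hn hx.le, show (m + n + 1 - 2 * s : ℝ) =
          (m - s) + (n + 1 - s) by ring, Real.rpow_add (by linarith)]
      ring
    rw [this, integral_const_mul, integral_Ioi_rpow_of_lt (by linarith) zero_lt_one, Real.one_rpow]
    have h4 : (2 * s - m - n - 2 : ℝ) ≠ 0 := by linarith
    have h5 : (m + n + 1 - 2 * s + 1 : ℝ) ≠ 0 := by linarith
    rw [show (m + n + 1 - 2 * s + 1 : ℝ) = -(2 * s - m - n - 2) by ring, neg_div_neg_eq]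
    field_simp
  rw [h2, h3]
  have h4 : (2 * s - m - n - 2 : ℝ) ≠ 0 := by linarith
  field_simp
  ring

end RealMahler

/-! ### The complex part of the form, and the total moments. -/

namespace RealMahler

open Filter Topology Finset MeasureTheory Set

/-- The integrand of the complex part of the skew form on monomials. -/
noncomputable def complexIntegrand (s : ℝ) (m n : ℕ) (z : ℂ) : ℂ :=
  (((max 1 ‖z‖) ^ (-2 * s) : ℝ) : ℂ) * (starRingEnd ℂ) z ^ m * z ^ n * ((Real.sign z.im : ℝ) : ℂ)

lemma integrable_complexIntegrand {s : ℝ} {m n : ℕ} (h : (m : ℝ) + n + 2 < 2 * s) :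
    Integrable (complexIntegrand s m n) := by
  have hfr : (Module.finrank ℝ ℂ : ℝ) < 2 * s - ((m + n : ℕ) : ℝ) := by
    rw [Complex.finrank_real_complex]; push_cast; linarith
  refine (integrable_max_one_norm_rpow (E := ℂ) volume hfr).mono' ?_
    (Eventually.of_forall fun z => ?_)
  · apply AEStronglyMeasurable.mul
    · apply Continuous.aestronglyMeasurable
      exact ((Complex.continuous_ofReal.comp (continuous_max_one_norm_rpow _)).mul
        (Complex.continuous_conj.pow m)).mul (continuous_pow n)
    · exact (Complex.measurable_ofReal.comp
        (measurable_sign.comp Complex.measurable_im)).aestronglyMeasurable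
  · rw [complexIntegrand, norm_mul, norm_mul, norm_mul, norm_pow, norm_pow, RCLike.norm_conj,
      Complex.norm_real, Complex.norm_real, Real.norm_of_nonneg (by positivity), mul_assoc _ (_ ^ m),
      ← pow_add, Real.norm_eq_abs]
    refine (mul_le_of_le_one_right (by positivity) (abs_sign_le_one _)).trans ?_
    rw [neg_mul]
    exact max_one_rpow_mul_pow_le _ _ (norm_nonneg z) (m + n)

/-- The complex part of the skew form on monomials. -/
noncomputable def complexMoment (s : ℝ) (m n : ℕ) : ℂ :=
  -2 * Complex.I * ∫ z : ℂ, complexIntegrand s m n z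

lemma skewFormComplex_eq_sum {s : ℝ} {M : ℕ} (hM : (M : ℝ) < s) (f g : Polynomial ℝ)
    (hf : f.natDegree < M) (hg : g.natDegree < M) :
    skewFormComplex s f g =
      ∑ m ∈ range M, ∑ n ∈ range M,
        (f.coeff m : ℂ) * (g.coeff n : ℂ) * complexMoment s m n := by
  have hlt : ∀ m ∈ range M, ∀ n ∈ range M, (m : ℝ) + n + 2 < 2 * s := fun m hm n hn => by
    have h1 : ((m : ℝ) + 1) ≤ M := by exact_mod_cast mem_range.1 hm
    have h2 : ((n : ℝ) + 1) ≤ M := by exact_mod_cast mem_range.1 hn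
    linarith
  have h1 : ∀ z : ℂ, (((max 1 ‖z‖) ^ (-2 * s) : ℝ) : ℂ) * (starRingEnd ℂ) (Polynomial.aeval z f) *
      Polynomial.aeval z g * ((Real.sign z.im : ℝ) : ℂ) = ∑ m ∈ range M, ∑ n ∈ range M,
        ((f.coeff m : ℂ) * (g.coeff n : ℂ)) * complexIntegrand s m n z := by
    intro z
    rw [Polynomial.aeval_eq_sum_range' hf, Polynomial.aeval_eq_sum_range' hg, map_sum,
      mul_assoc (Complex.ofReal _), Finset.sum_mul_sum, Finset.mul_sum, Finset.sum_mul]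
    refine Finset.sum_congr rfl fun m _ => ?_
    rw [Finset.mul_sum, Finset.sum_mul]
    refine Finset.sum_congr rfl fun n _ => ?_
    simp only [complexIntegrand, Complex.real_smul, map_mul, Complex.conj_ofReal, map_pow]
    ring
  rw [skewFormComplex]
  simp_rw [h1]
  rw [integral_finsetSum, Finset.mul_sum]
  · refine Finset.sum_congr rfl fun m hm => ?_
    rw [integral_finsetSum, Finset.mul_sum]
    · refine Finset.sum_congr rfl fun n hn => ?_
      rw [integral_const_mul, complexMoment]
      ring
    · intro n hn
      exact (integrable_complexIntegrand (hlt m hm n hn)).const_mul _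
  · intro m hm
    exact integrable_finsetSum _ fun n hn =>
      (integrable_complexIntegrand (hlt m hm n hn)).const_mul _

lemma complexMoment_eq_zero {s : ℝ} {m n : ℕ} (h : Even (m + n)) : complexMoment s m n = 0 := by
  have h1 : ∫ z : ℂ, complexIntegrand s m n z = -∫ z : ℂ, complexIntegrand s m n z := by
    conv_lhs => rw [← integral_neg_eq_self]
    rw [← integral_neg]
    refine integral_congr_ae (Eventually.of_forall fun z => ?_)
    simp only [complexIntegrand, norm_neg, map_neg, Complex.neg_im, Real.sign_neg,
      Complex.ofReal_neg]
    rw [neg_pow, neg_pow z]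
    have : (-1 : ℂ) ^ m * (-1) ^ n = 1 := by rw [← pow_add, h.neg_one_pow]
    linear_combination (-(((max 1 ‖z‖) ^ (-2 * s) : ℝ) : ℂ) * (starRingEnd ℂ) z ^ m * z ^ n *
      ((Real.sign z.im : ℝ) : ℂ)) * this
  rw [complexMoment, self_eq_neg.1 h1, mul_zero]

/-- The sign of `sin θ` is constant on each half of the interval, and because `n - m` is odd the
exponential equals `-1` at both ends `±π` and `1` at `0`. -/
lemma integral_angular {m n : ℕ} (h : Odd (m + n)) :
    ∫ θ in Ioo (-Real.pi) Real.pi, Complex.exp ((n - m : ℂ) * Complex.I * θ) *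
      ((Real.sign (Real.sin θ) : ℝ) : ℂ) = 4 * Complex.I / (n - m) := by
  have hpi := Real.pi_pos
  have hc : (n - m : ℂ) ≠ 0 := by
    intro h0
    have : (n : ℂ) = m := sub_eq_zero.1 h0
    have : n = m := by exact_mod_cast this
    subst this
    exact (Nat.not_odd_iff_even.2 ⟨n, rfl⟩) h
  have hcI : (n - m : ℂ) * Complex.I ≠ 0 := mul_ne_zero hc Complex.I_ne_zero
  have e1 : Complex.exp ((n - m : ℂ) * Complex.I * (Real.pi : ℝ)) = -1 := by
    have : (n - m : ℂ) * Complex.I * (Real.pi : ℝ) = n * (Real.pi * Complex.I) -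
      m * (Real.pi * Complex.I) := by ring
    rw [this, Complex.exp_sub, Complex.exp_nat_mul, Complex.exp_nat_mul, Complex.exp_pi_mul_I]
    rw [div_eq_iff (pow_ne_zero _ (by norm_num)), ← pow_succ']
    rcases Nat.even_or_odd m with hm | hm
    · have hn : Odd n := (Nat.odd_add'.1 h).2 hm
      rw [hn.neg_one_pow, hm.add_one.neg_one_pow]
    · have hn : Even n := (Nat.odd_add.1 h).1 hm
      rw [hn.neg_one_pow, hm.add_one.neg_one_pow]
  have e2 : Complex.exp ((n - m : ℂ) * Complex.I * ((-Real.pi : ℝ) : ℂ)) = -1 := by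
    rw [Complex.ofReal_neg, mul_neg, Complex.exp_neg, e1]
    norm_num
  let F : ℝ → ℂ := fun θ => Complex.exp ((n - m : ℂ) * Complex.I * θ)
  have hF : Continuous F := by fun_prop
  have hI : ∀ S : Set ℝ, S ⊆ Icc (-Real.pi) Real.pi → IntegrableOn (fun θ =>
      F θ * ((Real.sign (Real.sin θ) : ℝ) : ℂ)) S := by
    intro S hS
    refine Integrable.mul_bdd (c := 1)
      ((hF.integrableOn_Icc (a := -Real.pi) (b := Real.pi)).mono_set hS) ?_ ?_
    · exact (Complex.measurable_ofReal.comp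
        (measurable_sign.comp Real.measurable_sin)).aestronglyMeasurable
    · refine Eventually.of_forall fun x => ?_
      rw [Complex.norm_real]
      exact abs_sign_le_one _
  rw [← integral_Ioc_eq_integral_Ioo, ← Ioc_union_Ioc_eq_Ioc (b := 0) (by linarith) hpi.le,
    setIntegral_union (Ioc_disjoint_Ioc_of_le le_rfl) measurableSet_Ioc
      (hI _ (Ioc_subset_Icc_self.trans (Icc_subset_Icc le_rfl hpi.le)))
      (hI _ (Ioc_subset_Icc_self.trans (Icc_subset_Icc (by linarith) le_rfl)))]
  have h1 : ∫ θ in Ioc (-Real.pi) 0, F θ * ((Real.sign (Real.sin θ) : ℝ) : ℂ) =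
      -∫ θ in (-Real.pi)..0, F θ := by
    rw [intervalIntegral.integral_of_le (by linarith), integral_Ioc_eq_integral_Ioo,
      integral_Ioc_eq_integral_Ioo, ← integral_neg]
    refine setIntegral_congr_fun measurableSet_Ioo fun θ hθ => ?_
    rw [Real.sign_of_neg (Real.sin_neg_of_neg_of_neg_pi_lt hθ.2 hθ.1)]
    simp
  have h2 : ∫ θ in Ioc 0 Real.pi, F θ * ((Real.sign (Real.sin θ) : ℝ) : ℂ) =
      ∫ θ in (0)..Real.pi, F θ := by
    rw [intervalIntegral.integral_of_le hpi.le, integral_Ioc_eq_integral_Ioo,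
      integral_Ioc_eq_integral_Ioo]
    refine setIntegral_congr_fun measurableSet_Ioo fun θ hθ => ?_
    rw [Real.sign_of_pos (Real.sin_pos_of_mem_Ioo hθ)]
    simp
  rw [h1, h2, integral_exp_mul_complex hcI, integral_exp_mul_complex hcI, e1, e2]
  simp only [Complex.ofReal_zero, mul_zero, Complex.exp_zero]
  field_simp
  rw [Complex.I_sq]
  ring

/-- Polar coordinates separate the integral. The Jacobian raises the radial exponent to `m + n + 1`,
so the radial factor is a half-line integral already computed, with `2 s` in place of `s`. -/
lemma complexMoment_odd {s : ℝ} {m n : ℕ} (hs : (m : ℝ) + n + 2 < 2 * s) (h : Odd (m + n)) :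
    complexMoment s m n = 16 * s / ((n - m) * ((m + n + 2) * (2 * s - m - n - 2))) := by
  have h1 : ∫ z : ℂ, complexIntegrand s m n z =
      (∫ r in Ioi (0 : ℝ), ((wMonomial (2 * s) (m + n + 1) r : ℝ) : ℂ)) *
      ∫ θ in Ioo (-Real.pi) Real.pi, Complex.exp ((n - m : ℂ) * Complex.I * θ) *
        ((Real.sign (Real.sin θ) : ℝ) : ℂ) := by
    rw [← Complex.integral_comp_polarCoord_symm, ← setIntegral_prod_mul]
    refine setIntegral_congr_fun (by
      rw [polarCoord_target]; exact measurableSet_Ioi.prod measurableSet_Ioo) fun p hp => ?_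
    rw [polarCoord_target] at hp
    have hr : 0 < p.1 := hp.1
    have hz : Complex.polarCoord.symm p = p.1 * Complex.exp (p.2 * Complex.I) := by
      rw [Complex.polarCoord_symm_apply, Complex.exp_mul_I, Complex.ofReal_cos, Complex.ofReal_sin]
    have hnorm : ‖Complex.polarCoord.symm p‖ = p.1 := by
      rw [Complex.norm_polarCoord_symm, abs_of_pos hr]
    have him : (Complex.polarCoord.symm p).im = p.1 * Real.sin p.2 := by
      rw [hz, Complex.im_ofReal_mul, Complex.exp_ofReal_mul_I_im]
    have hsign : Real.sign (p.1 * Real.sin p.2) = Real.sign (Real.sin p.2) := by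
      rcases lt_trichotomy (Real.sin p.2) 0 with h0 | h0 | h0
      · rw [Real.sign_of_neg h0, Real.sign_of_neg (mul_neg_of_pos_of_neg hr h0)]
      · rw [h0, mul_zero]
      · rw [Real.sign_of_pos h0, Real.sign_of_pos (mul_pos hr h0)]
    rw [complexIntegrand, hnorm, him, hsign, hz, map_mul, Complex.conj_ofReal, ← Complex.exp_conj,
      map_mul, Complex.conj_I, Complex.conj_ofReal, wMonomial, abs_of_pos hr, mul_pow, mul_pow,
      ← Complex.exp_nat_mul, ← Complex.exp_nat_mul]
    have he : Complex.exp ((n - m : ℂ) * Complex.I * p.2) =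
      Complex.exp (m * (p.2 * -Complex.I)) * Complex.exp (n * (p.2 * Complex.I)) := by
      rw [← Complex.exp_add]; ring_nf
    rw [he, Complex.real_smul]
    push_cast
    rw [neg_mul]
    ring
  rw [complexMoment, h1, integral_angular h, integral_complex_ofReal,
    integral_Ioi_zero_wMonomial (by push_cast; linarith)]
  have h2 : (m + n + 2 : ℂ) ≠ 0 := by exact_mod_cast (by omega : m + n + 2 ≠ 0)
  have h3 : (2 * s - m - n - 2 : ℂ) ≠ 0 := by
    have : (2 * s - m - n - 2 : ℝ) ≠ 0 := by linarith
    exact_mod_cast this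
  push_cast
  rw [show (m + n + 1 + 1 : ℂ) = m + n + 2 by ring,
    show (2 * s - (m + n + 1) - 1 : ℂ) = 2 * s - m - n - 2 by ring]
  field_simp
  rw [Complex.I_sq]
  ring

/-- The skew form on monomials. -/
noncomputable def moment (s : ℝ) (m n : ℕ) : ℂ := (realMoment s m n : ℂ) + complexMoment s m n

lemma skewForm_eq_sum {s : ℝ} {M : ℕ} (hM : (M : ℝ) < s) (f g : Polynomial ℝ)
    (hf : f.natDegree < M) (hg : g.natDegree < M) :
    skewForm s f g =
      ∑ m ∈ range M, ∑ n ∈ range M, (f.coeff m : ℂ) * (g.coeff n : ℂ) * moment s m n := by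
  rw [skewForm, skewFormReal_eq_sum hM f g hf hg, skewFormComplex_eq_sum hM f g hf hg]
  push_cast
  simp_rw [← Finset.sum_add_distrib, moment, mul_add]

lemma moment_eq_zero {s : ℝ} {m n : ℕ} (h : Even (m + n)) : moment s m n = 0 := by
  simp [moment, realMoment_eq_zero h, complexMoment_eq_zero h]

/-- The denominators `m + n + 2` and `2 s - m - n - 2` of the two parts cancel in their sum. What
remains is the Cauchy kernel `1 / (n - m)` with a row factor and a column factor, which makes
explicit skew-orthogonal polynomials possible. -/
lemma moment_even_odd {s : ℝ} {m n : ℕ} (hm : (m : ℝ) + 1 < s) (hn : (n : ℝ) + 1 < s)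
    (em : Even m) (on : Odd n) :
    moment s m n = 4 * s / ((s - n - 1) * (m + 1) * (n - m)) := by
  rw [moment, realMoment_even_odd hm hn em on, complexMoment_odd (by linarith) (em.add_odd on)]
  have h1 : (n - m : ℝ) ≠ 0 := by
    intro h
    have : n = m := by exact_mod_cast sub_eq_zero.1 h
    subst this
    exact (Nat.not_odd_iff_even.2 em) on
  have h2 : (s - n - 1 : ℝ) ≠ 0 := by linarith
  have h3 : (2 * s - m - n - 2 : ℝ) ≠ 0 := by linarith
  have key : 4 * (1 / ((s - n - 1) * (m + 1)) + 1 / ((m + 1) * (m + n + 2)) +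
      1 / ((s - n - 1) * (2 * s - m - n - 2))) +
      16 * s / ((n - m) * ((m + n + 2) * (2 * s - m - n - 2))) =
      4 * s / ((s - n - 1) * (m + 1) * (n - m)) := by
    have h4 : (m + n + 2 : ℝ) ≠ 0 := by positivity
    have h5 : (m + 1 : ℝ) ≠ 0 := by positivity
    -- In the variables `a = m + 1`, `b = s - n - 1`, `k = n - m`, everything else is linear: `D = 2
    -- b + k`, `e = 2 a + k`, `s = a + b + k`.
    generalize hD : (2 * s - m - n - 2 : ℝ) = D at *
    generalize hb : (s - n - 1 : ℝ) = b at *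
    generalize hk : (n - m : ℝ) = k at *
    generalize he : (m + n + 2 : ℝ) = e at *
    generalize ha : (m + 1 : ℝ) = a at *
    have e1 : D = 2 * b + k := by linarith
    have e2 : e = 2 * a + k := by linarith
    have e3 : s = b + a + k := by linarith
    field_simp
    rw [e1, e2, e3]
    ring
  exact_mod_cast congrArg (fun x : ℝ => (x : ℂ)) key

lemma moment_swap {s : ℝ} {m n : ℕ} (hm : (m : ℝ) + 1 < s) (hn : (n : ℝ) + 1 < s) :
    moment s m n = -moment s n m := by
  rcases Nat.even_or_odd (m + n) with h | h
  · rw [moment_eq_zero h, moment_eq_zero (by rwa [add_comm]), neg_zero]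
  · rw [moment, moment, realMoment_swap hm hn, complexMoment_odd (by linarith) h,
      complexMoment_odd (by linarith) (by rwa [add_comm])]
    have : (n - m : ℂ) = -(m - n) := by ring
    rw [this, neg_mul, div_neg]
    push_cast
    ring_nf

end RealMahler

/-! ### Skew-orthonormality and the kernel in the skew-orthonormal basis. -/

namespace RealMahler

open Filter Topology Finset MeasureTheory Set

lemma sum_range_two_mul {E : Type*} [AddCommMonoid E] (F : ℕ → E) (J : ℕ) :
    ∑ m ∈ range (2 * J), F m = ∑ j ∈ range J, (F (2 * j) + F (2 * j + 1)) := by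
  induction J with
  | zero => simp
  | succ J ih =>
    rw [Finset.sum_range_succ, ← ih, mul_add, mul_one, Finset.sum_range_succ, Finset.sum_range_succ,
      add_assoc]

lemma coeff_piEven_even (n i : ℕ) : (piEven n).coeff (2 * i) =
    if i ≤ n then (2 * (i : ℝ) + 1) * invSqrtCoeff i * invSqrtCoeff (n - i) else 0 := by
  rw [piEven_eq, Polynomial.finsetSum_coeff]
  simp only [Polynomial.coeff_C_mul, Polynomial.coeff_X_pow, mul_ite, mul_one, mul_zero]
  split_ifs with h
  · rw [Finset.sum_eq_single i]
    · simp
    · intro b _ hb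
      rw [if_neg (by omega)]
    · intro hi
      simp at hi
      omega
  · refine Finset.sum_eq_zero fun k hk => ?_
    have := mem_range.1 hk
    rw [if_neg (by omega)]

lemma coeff_piEven_odd (n i : ℕ) : (piEven n).coeff (2 * i + 1) = 0 := by
  rw [piEven_eq, Polynomial.finsetSum_coeff]
  refine Finset.sum_eq_zero fun k hk => ?_
  rw [Polynomial.coeff_C_mul, Polynomial.coeff_X_pow, if_neg (by omega), mul_zero]

lemma coeff_piOdd_odd {s : ℝ} (hs : s ≠ 0) (n i : ℕ) : (piOdd s n).coeff (2 * i + 1) =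
    if i ≤ n then (s - 2 * i - 2) / (4 * s) * ((2 * (i : ℝ) + 1) * invSqrtCoeff i *
      sqrtCoeff (n - i)) else 0 := by
  rw [piOdd_eq s hs, Polynomial.finsetSum_coeff]
  simp only [Polynomial.coeff_C_mul, Polynomial.coeff_X_pow, mul_ite, mul_one, mul_zero]
  split_ifs with h
  · rw [Finset.sum_eq_single i]
    · simp
    · intro b _ hb
      rw [if_neg (by omega)]
    · intro hi
      simp at hi
      omega
  · refine Finset.sum_eq_zero fun k hk => ?_
    have := mem_range.1 hk
    rw [if_neg (by omega)]

lemma coeff_piOdd_even {s : ℝ} (hs : s ≠ 0) (n i : ℕ) : (piOdd s n).coeff (2 * i) = 0 := by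
  rw [piOdd_eq s hs, Polynomial.finsetSum_coeff]
  refine Finset.sum_eq_zero fun k hk => ?_
  rw [Polynomial.coeff_C_mul, Polynomial.coeff_X_pow, if_neg (by omega), mul_zero]

lemma natDegree_piEven_le (n : ℕ) : (piEven n).natDegree ≤ 2 * n := by
  rw [piEven_eq]
  refine Polynomial.natDegree_sum_le_of_forall_le _ _ fun k hk => ?_
  have := mem_range.1 hk
  exact (Polynomial.natDegree_C_mul_X_pow_le _ _).trans (by omega)

lemma natDegree_piOdd_le {s : ℝ} (hs : s ≠ 0) (n : ℕ) : (piOdd s n).natDegree ≤ 2 * n + 1 := by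
  rw [piOdd_eq s hs]
  refine Polynomial.natDegree_sum_le_of_forall_le _ _ fun k hk => ?_
  have := mem_range.1 hk
  exact (Polynomial.natDegree_C_mul_X_pow_le _ _).trans (by omega)

lemma cast_add_one_lt {s : ℝ} {M m : ℕ} (hM : (M : ℝ) < s) (hm : m < M) : (m : ℝ) + 1 < s := by
  have : (m : ℝ) + 1 ≤ M := by exact_mod_cast hm
  linarith

/-- The factor `2 i + 1` of the even coefficients cancels the row factor of the moment, and `(s - 2
k - 2) / (4 s)` of the odd ones cancels the column factor. What is left is `biorthogonality`. -/
lemma skewForm_piEven_piOdd {s : ℝ} {J n n' : ℕ} (hJ : ((2 * J : ℕ) : ℝ) < s) (hn : n < J)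
    (hn' : n' < J) : skewForm s (piEven n) (piOdd s n') = if n = n' then 1 else 0 := by
  have hs0 : 0 < s := (Nat.cast_nonneg _).trans_lt hJ
  rw [skewForm_eq_sum hJ _ _ ((natDegree_piEven_le n).trans_lt (by omega))
    ((natDegree_piOdd_le hs0.ne' n').trans_lt (by omega)), sum_range_two_mul]
  simp_rw [sum_range_two_mul]
  simp only [coeff_piEven_odd, coeff_piOdd_even hs0.ne', Complex.ofReal_zero, mul_zero, zero_mul,
    zero_add, Finset.sum_const_zero, add_zero]
  have h := congrArg (fun x : ℝ => (x : ℂ)) (biorthogonality n n')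
  have hr : ((if n = n' then (1 : ℝ) else 0 : ℝ) : ℂ) = if n = n' then 1 else 0 := by
    split_ifs <;> simp
  rw [hr] at h
  rw [← h, Complex.ofReal_sum]
  symm
  -- The sums run up to the common bound `J`; coefficients beyond `n` and `n'` vanish.
  refine Finset.sum_subset_zero_on_sdiff (range_subset_range.2 (by omega)) ?_ ?_
  · intro i hi
    simp only [Finset.mem_sdiff, Finset.mem_range] at hi
    rw [Finset.sum_eq_zero]
    intro k _
    rw [coeff_piEven_even, if_neg (by omega)]
    simp
  · intro i hi
    rw [Complex.ofReal_sum]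
    refine Finset.sum_subset_zero_on_sdiff (range_subset_range.2 (by omega)) ?_ ?_
    · intro k hk
      simp only [Finset.mem_sdiff, Finset.mem_range] at hk
      rw [coeff_piOdd_odd hs0.ne', if_neg (by omega)]
      simp
    · intro k hk
      have hi' := mem_range.1 hi
      have hk' := mem_range.1 hk
      rw [coeff_piEven_even, if_pos (by omega), coeff_piOdd_odd hs0.ne', if_pos (by omega),
        moment_even_odd (cast_add_one_lt hJ (by omega)) (cast_add_one_lt hJ (by omega))
          (even_two_mul i) (odd_two_mul_add_one k)]
      have hk2 : s - 2 * k - 2 ≠ 0 := by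
        have := cast_add_one_lt hJ (show 2 * k + 1 < 2 * J by omega)
        push_cast at this
        linarith
      have hne : (2 * k + 1 - 2 * i : ℝ) ≠ 0 := fun h => by
        have h2 : (2 * k + 1 : ℝ) = 2 * i := by linarith
        have h3 : 2 * k + 1 = 2 * i := by exact_mod_cast h2
        omega
      have key : invSqrtCoeff i * invSqrtCoeff (n - i) *
          ((2 * (k : ℝ) + 1) * invSqrtCoeff k * sqrtCoeff (n' - k)) / (2 * k + 1 - 2 * i) =
          (2 * (i : ℝ) + 1) * invSqrtCoeff i * invSqrtCoeff (n - i) * ((s - 2 * k - 2) / (4 * s) *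
            ((2 * (k : ℝ) + 1) * invSqrtCoeff k * sqrtCoeff (n' - k))) *
          (4 * s / ((s - ((2 * k + 1 : ℕ) : ℝ) - 1) * (((2 * i : ℕ) : ℝ) + 1) *
            (((2 * k + 1 : ℕ) : ℝ) - ((2 * i : ℕ) : ℝ)))) := by
        push_cast
        rw [show s - (2 * k + 1) - 1 = s - 2 * k - 2 by ring]
        field_simp
      rw [key]
      push_cast
      rfl

lemma skewForm_swap {s : ℝ} {M : ℕ} (hM : (M : ℝ) < s) (f g : Polynomial ℝ)
    (hf : f.natDegree < M) (hg : g.natDegree < M) : skewForm s f g = -skewForm s g f := by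
  rw [skewForm_eq_sum hM f g hf hg, skewForm_eq_sum hM g f hg hf, Finset.sum_comm,
    ← Finset.sum_neg_distrib]
  refine Finset.sum_congr rfl fun n hn => ?_
  rw [← Finset.sum_neg_distrib]
  refine Finset.sum_congr rfl fun m hm => ?_
  rw [moment_swap (cast_add_one_lt hM (mem_range.1 hm)) (cast_add_one_lt hM (mem_range.1 hn))]
  ring

lemma skewForm_piEven_piEven {s : ℝ} {J n n' : ℕ} (hJ : ((2 * J : ℕ) : ℝ) < s) (hn : n < J)
    (hn' : n' < J) : skewForm s (piEven n) (piEven n') = 0 := by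
  rw [skewForm_eq_sum hJ _ _ ((natDegree_piEven_le n).trans_lt (by omega))
    ((natDegree_piEven_le n').trans_lt (by omega)), sum_range_two_mul]
  simp_rw [sum_range_two_mul]
  simp only [coeff_piEven_odd, Complex.ofReal_zero, mul_zero, zero_mul, Finset.sum_const_zero,
    add_zero]
  refine Finset.sum_eq_zero fun i _ => Finset.sum_eq_zero fun k _ => ?_
  rw [moment_eq_zero ((even_two_mul i).add (even_two_mul k)), mul_zero]

lemma skewForm_piOdd_piOdd {s : ℝ} {J n n' : ℕ} (hJ : ((2 * J : ℕ) : ℝ) < s) (hn : n < J)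
    (hn' : n' < J) : skewForm s (piOdd s n) (piOdd s n') = 0 := by
  have hs0 : 0 < s := (Nat.cast_nonneg _).trans_lt hJ
  rw [skewForm_eq_sum hJ _ _ ((natDegree_piOdd_le hs0.ne' n).trans_lt (by omega))
    ((natDegree_piOdd_le hs0.ne' n').trans_lt (by omega)), sum_range_two_mul]
  simp_rw [sum_range_two_mul]
  simp only [coeff_piOdd_even hs0.ne', Complex.ofReal_zero, mul_zero, zero_mul,
    Finset.sum_const_zero, zero_add]
  refine Finset.sum_eq_zero fun i _ => Finset.sum_eq_zero fun k _ => ?_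
  rw [moment_eq_zero ((odd_two_mul_add_one i).add_odd (odd_two_mul_add_one k)), mul_zero]

/-- The sequence of skew-orthonormal polynomials. -/
noncomputable def piSeq (s : ℝ) (n : ℕ) : Polynomial ℝ :=
  if Even n then piEven (n / 2) else piOdd s (n / 2)

lemma piSeq_even (s : ℝ) (j : ℕ) : piSeq s (2 * j) = piEven j := by
  rw [piSeq, if_pos (even_two_mul j), Nat.mul_div_cancel_left _ two_pos]

lemma piSeq_odd (s : ℝ) (j : ℕ) : piSeq s (2 * j + 1) = piOdd s j := by
  rw [piSeq, if_neg (Nat.not_even_iff_odd.2 (odd_two_mul_add_one j)),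
    show (2 * j + 1) / 2 = j by omega]

/-- The entries of the standard symplectic matrix. -/
def sympl (m n : ℕ) : ℂ :=
  if Even m then (if n = m + 1 then 1 else 0) else (if n + 1 = m then -1 else 0)

lemma skewForm_piSeq {s : ℝ} {J m n : ℕ} (hJ : ((2 * J : ℕ) : ℝ) < s) (hm : m < 2 * J)
    (hn : n < 2 * J) : skewForm s (piSeq s m) (piSeq s n) = sympl m n := by
  have hs0 : 0 < s := (Nat.cast_nonneg _).trans_lt hJ
  rcases Nat.even_or_odd' m with ⟨i, rfl | rfl⟩ <;> rcases Nat.even_or_odd' n with ⟨k, rfl | rfl⟩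
  · rw [piSeq_even, piSeq_even, skewForm_piEven_piEven hJ (by omega) (by omega), sympl,
      if_pos (even_two_mul i), if_neg (by omega)]
  · rw [piSeq_even, piSeq_odd, skewForm_piEven_piOdd hJ (by omega) (by omega), sympl,
      if_pos (even_two_mul i)]
    split_ifs <;> first | rfl | omega
  · rw [piSeq_even, piSeq_odd, skewForm_swap hJ _ _
      ((natDegree_piOdd_le hs0.ne' i).trans_lt (by omega))
      ((natDegree_piEven_le k).trans_lt (by omega)),
      skewForm_piEven_piOdd hJ (by omega) (by omega), sympl,
      if_neg (Nat.not_even_iff_odd.2 (odd_two_mul_add_one i))]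
    split_ifs <;> first | omega | simp
  · rw [piSeq_odd, piSeq_odd, skewForm_piOdd_piOdd hJ (by omega) (by omega), sympl,
      if_neg (Nat.not_even_iff_odd.2 (odd_two_mul_add_one i)), if_neg (by omega)]

lemma natDegree_piSeq_le {s : ℝ} (hs : s ≠ 0) (n : ℕ) : (piSeq s n).natDegree ≤ n := by
  rcases Nat.even_or_odd' n with ⟨i, rfl | rfl⟩
  · rw [piSeq_even]; exact natDegree_piEven_le i
  · rw [piSeq_odd]; exact natDegree_piOdd_le hs i

/-- The symplectic matrix of size `2 J`. -/
def symplMatrix (J : ℕ) : Matrix (Fin (2 * J)) (Fin (2 * J)) ℂ := Matrix.of fun m n => sympl m n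

lemma sum_sympl_mul (J m : ℕ) (hm : m < 2 * J) (F : ℕ → ℂ) :
    ∑ n ∈ range (2 * J), sympl m n * F n = if Even m then F (m + 1) else -F (m - 1) := by
  unfold sympl
  split_ifs with h
  · rw [Finset.sum_eq_single (m + 1)]
    · simp
    · intro b _ hb
      rw [if_neg hb, zero_mul]
    · intro h2
      rw [Finset.mem_range] at h2
      obtain ⟨i, rfl⟩ := h
      omega
  · have : 1 ≤ m := by
      rcases Nat.eq_zero_or_pos m with h0 | h0
      · subst h0; simp at h
      · exact h0
    rw [Finset.sum_eq_single (m - 1)]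
    · rw [if_pos (by omega)]; ring
    · intro b _ hb
      rw [if_neg (by omega), zero_mul]
    · intro h2
      rw [Finset.mem_range] at h2
      omega

lemma symplMatrix_mul_self (J : ℕ) : symplMatrix J * -symplMatrix J = 1 := by
  ext m n
  rw [Matrix.mul_neg, Matrix.neg_apply, Matrix.mul_apply]
  simp only [symplMatrix, Matrix.of_apply]
  rw [Finset.sum_range (fun k => sympl m k * sympl k n) |>.symm,
    sum_sympl_mul J m m.2 (fun k => sympl k n), Matrix.one_apply]
  have hm : (m = n) ↔ ((m : ℕ) = n) := Fin.ext_iff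
  simp only [hm]
  generalize (m : ℕ) = a
  generalize (n : ℕ) = b
  rcases Nat.even_or_odd' a with ⟨i, rfl | rfl⟩
  · rw [if_pos (even_two_mul i), sympl, if_neg (Nat.not_even_iff_odd.2 (odd_two_mul_add_one i))]
    split_ifs <;> first | omega | simp
  · rw [if_neg (Nat.not_even_iff_odd.2 (odd_two_mul_add_one i)), Nat.add_sub_cancel, sympl,
      if_pos (even_two_mul i)]
    split_ifs <;> first | omega | simp

/-- The coefficient matrix of a sequence of polynomials. -/
def coeffMatrix (p : ℕ → Polynomial ℝ) (M : ℕ) : Matrix (Fin M) (Fin M) ℂ :=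
  Matrix.of fun m n => ((p m).coeff n : ℂ)

/-- The Gram matrix of the monomials. -/
noncomputable def momentMatrix (s : ℝ) (M : ℕ) : Matrix (Fin M) (Fin M) ℂ :=
  Matrix.of fun m n => moment s m n

lemma gram_eq {s : ℝ} {M : ℕ} (hM : (M : ℝ) < s) (p : ℕ → Polynomial ℝ)
    (hp : ∀ n, (p n).natDegree ≤ n) :
    gram s p M = coeffMatrix p M * momentMatrix s M * (coeffMatrix p M).transpose := by
  ext m n
  simp only [gram, Matrix.of_apply, Matrix.mul_apply, coeffMatrix, momentMatrix,
    Matrix.transpose_apply]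
  rw [skewForm_eq_sum hM _ _ ((hp m).trans_lt m.2) ((hp n).trans_lt n.2), Finset.sum_comm,
    Finset.sum_range]
  refine Finset.sum_congr rfl fun k _ => ?_
  rw [Finset.sum_range, Finset.sum_mul]
  exact Finset.sum_congr rfl fun i _ => by ring

lemma det_coeffMatrix {p : ℕ → Polynomial ℝ} (hmonic : ∀ n, (p n).Monic)
    (hdeg : ∀ n, (p n).natDegree = n) (M : ℕ) : (coeffMatrix p M).det = 1 := by
  rw [Matrix.det_of_isLowerTriangular]
  · refine Finset.prod_eq_one fun i _ => ?_
    have := (hmonic i).coeff_natDegree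
    rw [hdeg] at this
    simp [coeffMatrix, this]
  · intro i j hij
    have hij : i < j := hij
    simp only [coeffMatrix, Matrix.of_apply]
    rw [Polynomial.coeff_eq_zero_of_natDegree_lt (by rw [hdeg]; exact hij), Complex.ofReal_zero]

lemma aeval_eq_mulVec {p : ℕ → Polynomial ℝ} {M : ℕ} (hp : ∀ n, (p n).natDegree ≤ n) (u : ℂ) :
    (fun m : Fin M => Polynomial.aeval u (p m)) =
      (coeffMatrix p M).mulVec fun m : Fin M => u ^ (m : ℕ) := by
  ext m
  rw [Polynomial.aeval_eq_sum_range' ((hp m).trans_lt m.2), Finset.sum_range]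
  simp [coeffMatrix, Matrix.mulVec, dotProduct]

/-- `(P A Pᵀ)⁻¹ = P⁻ᵀ A⁻¹ P⁻¹`, and the outer factors cancel those on the vectors. With `P` the
coefficient matrix, this is the independence of the kernel from the chosen polynomials. -/
lemma dotProduct_inv_congr {ι : Type*} [Fintype ι] [DecidableEq ι] (P A : Matrix ι ι ℂ)
    (hP : IsUnit P.det) (x y : ι → ℂ) :
    dotProduct (P.mulVec x) ((P * A * P.transpose)⁻¹.mulVec (P.mulVec y)) =
      dotProduct x (A⁻¹.mulVec y) := by
  have hT : IsUnit P.transpose.det := by rwa [Matrix.det_transpose]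
  rw [Matrix.mul_inv_rev, Matrix.mul_inv_rev, Matrix.mulVec_mulVec, Matrix.mul_assoc,
    Matrix.mul_assoc, Matrix.nonsing_inv_mul _ hP, mul_one, dotProduct_comm,
    Matrix.dotProduct_mulVec, ← Matrix.mulVec_transpose, Matrix.mulVec_mulVec, ← Matrix.mul_assoc,
    Matrix.mul_nonsing_inv _ hT, one_mul, dotProduct_comm]

lemma sum_gram_inv {s : ℝ} {M : ℕ} (hM : (M : ℝ) < s) (p : ℕ → Polynomial ℝ)
    (hp : ∀ n, (p n).natDegree ≤ n) (hdet : IsUnit (coeffMatrix p M).det) (u v : ℂ) :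
    ∑ m : Fin M, ∑ n : Fin M,
      (gram s p M)⁻¹ m n * Polynomial.aeval u (p m) * Polynomial.aeval v (p n) =
    dotProduct (fun m : Fin M => u ^ (m : ℕ))
      ((momentMatrix s M)⁻¹.mulVec fun m : Fin M => v ^ (m : ℕ)) := by
  rw [← dotProduct_inv_congr _ _ hdet, ← gram_eq hM p hp, ← aeval_eq_mulVec hp,
    ← aeval_eq_mulVec hp]
  simp only [dotProduct, Matrix.mulVec, Finset.mul_sum]
  exact Finset.sum_congr rfl fun m _ => Finset.sum_congr rfl fun n _ => by ring

/-- The even kernel in terms of the skew-orthonormal polynomials. -/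
lemma kernelEven_eq {s : ℝ} {J : ℕ} (hJ : ((2 * J : ℕ) : ℝ) < s) {p : ℕ → Polynomial ℝ}
    (hmonic : ∀ n, (p n).Monic) (hdeg : ∀ n, (p n).natDegree = n) (u v : ℂ) :
    kernelEven s p (2 * J) u v = 2 * (weight s u : ℂ) * (weight s v : ℂ) *
      ∑ j ∈ range J, (Polynomial.aeval u (piEven j) * Polynomial.aeval v (piOdd s j) -
        Polynomial.aeval v (piEven j) * Polynomial.aeval u (piOdd s j)) := by
  have hs0 : 0 < s := (Nat.cast_nonneg _).trans_lt hJ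
  have hq := natDegree_piSeq_le hs0.ne'
  have hgram : gram s (piSeq s) (2 * J) = symplMatrix J := by
    ext m n
    exact skewForm_piSeq hJ m.2 n.2
  have hinv := symplMatrix_mul_self J
  -- The skew-orthonormal polynomials are not monic. Their coefficient matrix is invertible because
  -- its determinant divides that of the symplectic matrix, which is a unit.
  have hdet : IsUnit (coeffMatrix (piSeq s) (2 * J)).det := by
    have h1 := congrArg Matrix.det hinv
    rw [← hgram, gram_eq hJ _ hq, Matrix.det_mul, Matrix.det_mul, Matrix.det_mul, Matrix.det_one,
      mul_assoc, mul_assoc] at h1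
    exact IsUnit.of_mul_eq_one _ h1
  -- The basis is changed from `p` to the monomials and on to the skew-orthonormal polynomials,
  -- whose Gram matrix has minus itself as inverse; this turns the prefactor `-2` into `2`.
  rw [kernelEven, sum_gram_inv hJ p (fun n => (hdeg n).le)
    (by rw [det_coeffMatrix hmonic hdeg]; exact isUnit_one), ← sum_gram_inv hJ _ hq hdet, hgram,
    Matrix.inv_eq_right_inv hinv]
  simp only [symplMatrix, Matrix.neg_apply, Matrix.of_apply]
  have h2 : ∑ m : Fin (2 * J), ∑ n : Fin (2 * J), -sympl m n * Polynomial.aeval u (piSeq s m) *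
      Polynomial.aeval v (piSeq s n) = ∑ m ∈ range (2 * J), -Polynomial.aeval u (piSeq s m) *
        ∑ n ∈ range (2 * J), sympl m n * Polynomial.aeval v (piSeq s n) := by
    rw [Finset.sum_range]
    refine Finset.sum_congr rfl fun m _ => ?_
    rw [Finset.sum_range, Finset.mul_sum]
    exact Finset.sum_congr rfl fun n _ => by ring
  rw [h2, Finset.sum_congr rfl fun m hm => by rw [sum_sympl_mul J m (mem_range.1 hm)
    fun n => Polynomial.aeval v (piSeq s n)], sum_range_two_mul, neg_mul, neg_mul, neg_mul,
    ← mul_neg, ← Finset.sum_neg_distrib]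
  congr 1
  refine Finset.sum_congr rfl fun j _ => ?_
  rw [if_pos (even_two_mul j), if_neg (Nat.not_even_iff_odd.2 (odd_two_mul_add_one j)),
    Nat.add_sub_cancel, piSeq_even, piSeq_odd]
  ring

/-! ### The line integrals of the even polynomials. -/

/-- The weighted integral of `x ^ (2 k)` is `2 s / ((2 k + 1) (s - 2 k - 1))`. Its factor `2 k + 1`
cancels, leaving the partial fraction sum at `z = (s - 1) / 2`. -/
lemma lineIntegral_eq {s : ℝ} {J : ℕ} (hJ : 2 * (J : ℝ) + 1 < s) :
    lineIntegral s J = s * halfRatio J ((s - 1) / 2) := by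
  have hlt : ∀ k ∈ range (J + 1), ((2 * k : ℕ) : ℝ) + 1 < s := fun k hk => by
    have : (k : ℝ) ≤ J := by exact_mod_cast Nat.lt_succ_iff.1 (mem_range.1 hk)
    push_cast
    linarith
  have h1 : ∀ x : ℝ, (piEven J).eval x * (max 1 |x|) ^ (-s) = ∑ k ∈ range (J + 1),
      (2 * (k : ℝ) + 1) * invSqrtCoeff k * invSqrtCoeff (J - k) * wMonomial s (2 * k) x := by
    intro x
    rw [piEven_eq, Polynomial.eval_finsetSum, Finset.sum_mul]
    refine Finset.sum_congr rfl fun k _ => ?_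
    simp only [Polynomial.eval_mul, Polynomial.eval_C, Polynomial.eval_pow, Polynomial.eval_X,
      wMonomial]
    ring
  have h2 : ∀ k, ∫ x, wMonomial s (2 * k) x = 2 * ∫ x in Ioi 0, wMonomial s (2 * k) x := by
    intro k
    rw [← integral_comp_abs]
    refine integral_congr_ae (Eventually.of_forall fun x => ?_)
    rcases abs_choice x with hx | hx <;> simp only [hx]
    rw [wMonomial_neg, (even_two_mul k).neg_one_pow, one_mul]
  rw [lineIntegral]
  simp_rw [h1]
  rw [integral_finsetSum _ fun k hk => (integrable_wMonomial (hlt k hk)).const_mul _,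
    ← sum_invSqrtCoeff_div, Finset.mul_sum]
  · refine Finset.sum_congr rfl fun k hk => ?_
    have hk' := hlt k hk
    rw [integral_const_mul, h2, integral_Ioi_zero_wMonomial hk']
    push_cast at hk' ⊢
    have h3 : s - 2 * k - 1 ≠ 0 := by linarith
    have h4 : (s - 1) / 2 - k ≠ 0 := by
      intro h; apply h3; linarith
    rw [show (s - 1) / 2 - k = (s - 2 * k - 1) / 2 by ring]
    field_simp
  · intro k hk h
    have hk' := hlt k hk
    push_cast at hk'
    linarith

/-- The ratio of two line integrals as a product. -/
lemma lineIntegral_div {s : ℝ} {J : ℕ} (hJ : 2 * (J : ℝ) + 1 < s) (i : ℕ) (hi : i ≤ J) :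
    lineIntegral s (J - i) / lineIntegral s J =
      ∏ l ∈ range i, (s - 2 * J - 1 + 2 * l) / (s - 2 * J + 2 * l) := by
  have hle : ∀ j ≤ J, 2 * (j : ℝ) + 1 < s := fun j hj => by
    have : (j : ℝ) ≤ J := by exact_mod_cast hj
    linarith
  have hpos : ∀ j ≤ J, lineIntegral s j ≠ 0 := by
    intro j hj
    rw [lineIntegral_eq (hle j hj), halfRatio]
    have h1 := hle j hj
    have hj0 : (0 : ℝ) ≤ j := j.cast_nonneg
    refine mul_ne_zero (by linarith) (mul_ne_zero (inv_ne_zero (by linarith))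
      (Finset.prod_ne_zero_iff.2 fun k hk => ?_))
    have : (k : ℝ) + 1 ≤ j := by exact_mod_cast mem_range.1 hk
    exact div_ne_zero (by linarith) (by linarith)
  induction i with
  | zero => simp [hpos J le_rfl]
  | succ i ih =>
    rw [Finset.prod_range_succ, ← ih (by omega)]
    obtain ⟨m, hm⟩ := Nat.exists_eq_add_of_le hi
    have e1 : J - (i + 1) = m := by omega
    have e2 : J - i = m + 1 := by omega
    have h1 : lineIntegral s (m + 1) = lineIntegral s m * ((s - 2 * m - 2) / (s - 2 * m - 3)) := by
      rw [lineIntegral_eq (hle _ (by omega)), lineIntegral_eq (hle _ (by omega)), halfRatio,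
        Finset.prod_range_succ, halfRatio]
      have : ((s - 1) / 2 - m - 1 / 2) / ((s - 1) / 2 - m - 1) = (s - 2 * m - 2) / (s - 2 * m - 3) := by
        rw [show (s - 1) / 2 - m - 1 / 2 = (s - 2 * m - 2) / 2 by ring,
          show (s - 1) / 2 - m - 1 = (s - 2 * m - 3) / 2 by ring, div_div_div_cancel_right₀ two_ne_zero]
      rw [this]
      ring
    have h2 := hle (m + 1) (by omega)
    push_cast at h2
    have h3 : s - 2 * m - 2 ≠ 0 := by linarith
    have h4 : s - 2 * m - 3 ≠ 0 := by linarith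
    have h5 := hpos J le_rfl
    rw [e1, e2, h1]
    have hJm : (J : ℝ) = i + 1 + m := by exact_mod_cast hm
    have e3 : s - 2 * J - 1 + 2 * i = s - 2 * m - 3 := by rw [hJm]; ring
    have e4 : s - 2 * J + 2 * i = s - 2 * m - 2 := by rw [hJm]; ring
    rw [e3, e4]
    field_simp

end RealMahler

/-! ### Power series, the Wallis product and dominated convergence. -/

namespace RealMahler

open Filter Topology Finset

lemma hasSum_of_eq {f g : ℕ → ℂ} {a : ℂ} (h : HasSum f a) (hfg : ∀ k, f k = g k) :
    HasSum g a := by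
  rwa [← funext hfg]

/-- Both sides times `n!` are the rising factorial of `1/2`. This identifies `a_n` with the
coefficients of the analytic binomial series. -/
lemma choose_half_eq (n : ℕ) : Ring.choose (1 / 2 + n - 1 : ℂ) n = (invSqrtCoeff n : ℂ) := by
  have h := Ring.factorial_nsmul_multichoose_eq_ascPochhammer (1 / 2 : ℂ) n
  rw [Ring.multichoose_eq, nsmul_eq_mul] at h
  have h2 : ∀ n : ℕ, (ascPochhammer ℕ n).smeval (1 / 2 : ℂ) = n.factorial * (invSqrtCoeff n : ℂ) := by
    intro n
    induction n with
    | zero => simp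
    | succ n ih =>
      rw [ascPochhammer_succ_right, Polynomial.smeval_mul, ih, Polynomial.smeval_add,
        Polynomial.smeval_X, Polynomial.smeval_natCast, pow_one, pow_zero, nsmul_one,
        invSqrtCoeff_succ, Nat.factorial_succ]
      push_cast
      have : (n + 1 : ℂ) ≠ 0 := by exact_mod_cast n.succ_ne_zero
      field_simp
      ring
  rw [h2] at h
  exact mul_left_cancel₀ (by exact_mod_cast n.factorial_ne_zero) h

/-- The function `(1 - x) ^ (-1/2)`. -/
noncomputable def invSqrt (x : ℂ) : ℂ := 1 / (1 - x) ^ (1 / 2 : ℂ)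

lemma hasSum_invSqrt {x : ℂ} (hx : ‖x‖ < 1) :
    HasSum (fun k => (invSqrtCoeff k : ℂ) * x ^ k) (invSqrt x) := by
  have h := (Complex.one_div_one_sub_cpow_hasFPowerSeriesOnBall_zero (1 / 2)).hasSum
    (y := x) (by
      rw [Metric.mem_eball, edist_zero_right, ← ofReal_norm]
      exact ENNReal.ofReal_lt_one.2 hx)
  rw [zero_add] at h
  refine hasSum_of_eq h fun k => ?_
  rw [FormalMultilinearSeries.ofScalars_apply_eq, choose_half_eq, smul_eq_mul]

lemma summable_succ_mul_pow {ρ : ℝ} (h0 : 0 ≤ ρ) (h1 : ρ < 1) :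
    Summable fun k : ℕ => ((k : ℝ) + 1) * ρ ^ k := by
  have h := (summable_pow_mul_geometric_of_norm_lt_one 1
    (show ‖ρ‖ < 1 by rwa [Real.norm_of_nonneg h0])).add (summable_geometric_of_lt_one h0 h1)
  refine h.congr fun k => ?_
  rw [pow_one]
  ring

/-- The relation `b_{k+1} = a_{k+1} - a_k` is multiplication by `1 - x`. The sum is written through
`invSqrt` so that every later limit carries the same factor. -/
lemma hasSum_sqrtCoeff {x : ℂ} (hx : ‖x‖ < 1) :
    HasSum (fun k => (sqrtCoeff k : ℂ) * x ^ k) ((1 - x) * invSqrt x) := by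
  have h := hasSum_invSqrt hx
  have h1 := (hasSum_nat_add_iff' 1).2 h
  have h2 := h1.sub (h.mul_left x)
  refine (hasSum_nat_add_iff' 1).1 ?_
  have hv : (1 - x) * invSqrt x - ∑ i ∈ range 1, (sqrtCoeff i : ℂ) * x ^ i =
      invSqrt x - ∑ i ∈ range 1, (invSqrtCoeff i : ℂ) * x ^ i - x * invSqrt x := by
    simp
    ring
  rw [hv]
  refine hasSum_of_eq h2 fun k => ?_
  rw [sqrtCoeff_eq_sub]
  push_cast
  ring

lemma hasSum_mul_sqrtCoeff {x : ℂ} (hx : ‖x‖ < 1) :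
    HasSum (fun k : ℕ => (k : ℂ) * ((sqrtCoeff k : ℂ) * x ^ k)) (-(1 / 2) * x * invSqrt x) := by
  have h2 := (hasSum_invSqrt hx).mul_left (-(1 / 2) * x)
  refine (hasSum_nat_add_iff' 1).1 ?_
  rw [Finset.sum_range_one, Nat.cast_zero, zero_mul, sub_zero]
  refine hasSum_of_eq h2 fun k => ?_
  rw [sqrtCoeff_succ]
  push_cast
  have : (k + 1 : ℂ) ≠ 0 := by exact_mod_cast k.succ_ne_zero
  field_simp
  ring

/-- The leading coefficient `(2 n + 1) a_n` of `π_{2n}`. -/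
noncomputable def leadCoeff (n : ℕ) : ℝ := (2 * (n : ℝ) + 1) * invSqrtCoeff n

lemma leadCoeff_pos (n : ℕ) : 0 < leadCoeff n := by
  have := invSqrtCoeff_pos n
  unfold leadCoeff
  positivity

lemma leadCoeff_succ (n : ℕ) :
    leadCoeff (n + 1) = (2 * (n : ℝ) + 3) / (2 * n + 2) * leadCoeff n := by
  unfold leadCoeff
  rw [invSqrtCoeff_succ]
  push_cast
  field_simp
  ring

lemma leadCoeff_monotone : Monotone leadCoeff := by
  refine monotone_nat_of_le_succ fun n => ?_
  rw [leadCoeff_succ]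
  refine le_mul_of_one_le_left (leadCoeff_pos n).le ?_
  rw [one_le_div (by positivity)]
  linarith

/-- The two factors have reciprocal successive ratios. The Wallis limit then yields the growth of
the squared leading coefficient, and with it the constant `1 / π` of the theorem. -/
lemma wallis_eq (n : ℕ) : Real.Wallis.W n * (leadCoeff n ^ 2 / (2 * n + 1)) = 1 := by
  induction n with
  | zero => simp [Real.Wallis.W, leadCoeff]
  | succ n ih =>
    have h : Real.Wallis.W (n + 1) * (leadCoeff (n + 1) ^ 2 / (2 * ((n + 1 : ℕ) : ℝ) + 1)) =
        Real.Wallis.W n * (leadCoeff n ^ 2 / (2 * n + 1)) := by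
      rw [Real.Wallis.W_succ, leadCoeff_succ]
      push_cast
      field_simp
      ring
    rw [h, ih]

lemma tendsto_leadCoeff_sq :
    Tendsto (fun n : ℕ => leadCoeff n ^ 2 / (2 * n + 1)) atTop (𝓝 (2 / Real.pi)) := by
  have h := Real.Wallis.tendsto_W_nhds_pi_div_two.inv₀ (by positivity)
  rw [inv_div] at h
  exact h.congr fun n => (eq_inv_of_mul_eq_one_right (wallis_eq n)).symm

lemma tendsto_leadCoeff_ratio (m : ℕ) :
    Tendsto (fun J : ℕ => leadCoeff (J - m) / leadCoeff J) atTop (𝓝 1) := by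
  induction m with
  | zero =>
    refine tendsto_const_nhds.congr fun J => ?_
    rw [Nat.sub_zero, div_self (leadCoeff_pos J).ne']
  | succ m ih =>
    have h1 : Tendsto (fun n : ℕ => (2 * (n : ℝ) + 2) / (2 * n + 3)) atTop (𝓝 1) := by
      have h2 : Tendsto (fun n : ℕ => 1 - 1 / (2 * (n : ℝ) + 3)) atTop (𝓝 (1 - 0)) := by
        refine tendsto_const_nhds.sub (tendsto_const_nhds.div_atTop ?_)
        exact tendsto_atTop_add_const_right _ _
          (tendsto_natCast_atTop_atTop.const_mul_atTop two_pos)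
      rw [sub_zero] at h2
      refine h2.congr fun n => ?_
      field_simp
      ring
    have h3 := (h1.comp (tendsto_sub_atTop_nat (m + 1))).mul ih
    rw [one_mul] at h3
    refine h3.congr' ?_
    filter_upwards [eventually_ge_atTop (m + 1)] with J hJ
    have e : J - m = (J - (m + 1)) + 1 := by omega
    have h4 := (leadCoeff_pos J).ne'
    simp only [Function.comp]
    rw [e, leadCoeff_succ]
    field_simp

variable {α : Type*} {L : Filter α}

/-- Dominated convergence for sums of growing length. -/
lemma tendsto_sum_range_of_dominated {n : α → ℕ} (hn : Tendsto n L atTop) {f : α → ℕ → ℂ}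
    {g : ℕ → ℂ} {bound : ℕ → ℝ} (hb : Summable bound) (hb0 : ∀ k, 0 ≤ bound k)
    (hf : ∀ k, Tendsto (f · k) L (𝓝 (g k)))
    (hbound : ∀ᶠ t in L, ∀ k < n t, ‖f t k‖ ≤ bound k) :
    Tendsto (fun t => ∑ k ∈ range (n t), f t k) L (𝓝 (∑' k, g k)) := by
  have h := tendsto_tsum_of_dominated_convergence (𝓕 := L)
    (f := fun t k => if k < n t then f t k else 0) (g := g) hb ?_ ?_
  · refine h.congr fun t => ?_
    rw [tsum_eq_sum (s := range (n t)) fun k hk => if_neg (by simpa using hk)]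
    exact Finset.sum_congr rfl fun k hk => if_pos (Finset.mem_range.1 hk)
  · intro k
    refine (hf k).congr' ?_
    filter_upwards [hn.eventually_gt_atTop k] with t ht
    rw [if_pos ht]
  · filter_upwards [hbound] with t ht k
    split_ifs with hk
    · exact ht k hk
    · simpa using hb0 k

/-- `π_{2n}(z) / z ^ (2n)` as a function of `x = z⁻²`, normalized by the leading coefficient of
`π_{2J}`. -/
noncomputable def evenSum (J n : ℕ) (x : ℂ) : ℂ :=
  ∑ k ∈ range (n + 1), ((leadCoeff (n - k) / leadCoeff J : ℝ) : ℂ) * (invSqrtCoeff k : ℂ) * x ^ k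

/-- The normalization of `π_{2n+1}(z) / z ^ (2n+1)`, `n = J - (i + 1)`, as a function of
`x = z⁻²`. -/
noncomputable def oddSum (J i : ℕ) (e κ : ℝ) (x : ℂ) : ℂ :=
  ∑ k ∈ range (J - (i + 1) + 1), ((e + 2 * (i + k) * κ : ℝ) : ℂ) *
    ((leadCoeff (J - (i + 1) - k) / leadCoeff J : ℝ) : ℂ) * (sqrtCoeff k : ℂ) * x ^ k

lemma leadCoeff_ratio_le {J m : ℕ} (h : m ≤ J) : leadCoeff m / leadCoeff J ≤ 1 :=
  (div_le_one (leadCoeff_pos J)).2 (leadCoeff_monotone h)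

lemma leadCoeff_ratio_pos (J m : ℕ) : 0 < leadCoeff m / leadCoeff J :=
  div_pos (leadCoeff_pos m) (leadCoeff_pos J)

lemma norm_evenSum_term_le {J m : ℕ} (h : m ≤ J) (k : ℕ) {x : ℂ} {ρ : ℝ} (hx : ‖x‖ ≤ ρ) :
    ‖((leadCoeff m / leadCoeff J : ℝ) : ℂ) * (invSqrtCoeff k : ℂ) * x ^ k‖ ≤ ρ ^ k := by
  rw [norm_mul, norm_mul, norm_pow, Complex.norm_real, Complex.norm_real,
    Real.norm_of_nonneg (leadCoeff_ratio_pos _ _).le, Real.norm_of_nonneg (invSqrtCoeff_pos k).le]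
  have h1 := mul_le_one₀ (leadCoeff_ratio_le h) (invSqrtCoeff_pos k).le (invSqrtCoeff_le_one k)
  calc _ ≤ 1 * ‖x‖ ^ k := by gcongr
    _ ≤ ρ ^ k := by rw [one_mul]; gcongr

lemma norm_evenSum_le {J n : ℕ} (h : n ≤ J) {x : ℂ} {ρ : ℝ} (hx : ‖x‖ ≤ ρ) (hρ : ρ < 1) :
    ‖evenSum J n x‖ ≤ (1 - ρ)⁻¹ := by
  have h0 : 0 ≤ ρ := (norm_nonneg x).trans hx
  calc ‖evenSum J n x‖ ≤ ∑ k ∈ range (n + 1), ρ ^ k :=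
        norm_sum_le_of_le _ fun k _ => norm_evenSum_term_le (by omega) k hx
    _ ≤ ∑' k, ρ ^ k := (summable_geometric_of_lt_one h0 hρ).sum_le_tsum _ fun _ _ => by positivity
    _ = (1 - ρ)⁻¹ := tsum_geometric_of_lt_one h0 hρ

/-- The midpoint between `‖x₀‖` and `1` serves as a fixed geometric ratio below `1` for the
dominating series. -/
lemma eventually_norm_le {x : α → ℂ} {x₀ : ℂ} (hx : Tendsto x L (𝓝 x₀)) (h : ‖x₀‖ < 1) :
    ∀ᶠ t in L, ‖x t‖ ≤ (‖x₀‖ + 1) / 2 :=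
  hx.norm.eventually_le_const (by linarith)

lemma tendsto_evenSum {J : α → ℕ} (hJ : Tendsto J L atTop) {x : α → ℂ} {x₀ : ℂ}
    (hx : Tendsto x L (𝓝 x₀)) (h1 : ‖x₀‖ < 1) (m : ℕ) :
    Tendsto (fun t => evenSum (J t) (J t - m) (x t)) L (𝓝 (invSqrt x₀)) := by
  have h0 := norm_nonneg x₀
  rw [← (hasSum_invSqrt h1).tsum_eq]
  refine tendsto_sum_range_of_dominated
    (tendsto_add_atTop_nat 1 |>.comp ((tendsto_sub_atTop_nat m).comp hJ))
    (summable_geometric_of_lt_one (r := (‖x₀‖ + 1) / 2) (by linarith) (by linarith))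
    (fun k => by positivity) (fun k => ?_) ?_
  · have h2 := ((tendsto_leadCoeff_ratio (m + k)).comp hJ).ofReal
    have h3 := (h2.mul_const (invSqrtCoeff k : ℂ)).mul (hx.pow k)
    simp only [Complex.ofReal_one, one_mul] at h3
    refine h3.congr fun t => ?_
    simp only [Function.comp, Nat.sub_sub]
  · filter_upwards [eventually_norm_le hx h1] with t ht k _
    exact norm_evenSum_term_le (by omega) k ht

/-- The factor `e + 2 (i + k) κ` grows linearly in both indices; bounding it by a product in `i` and
`k` allows the two summations to be dominated separately. -/
lemma norm_oddSum_term_le {J m : ℕ} (h : m ≤ J) (i k : ℕ) {e κ C : ℝ} (he : |e| ≤ C)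
    (hκ : |κ| ≤ C) {x : ℂ} {ρ : ℝ} (hx : ‖x‖ ≤ ρ) :
    ‖((e + 2 * (i + k) * κ : ℝ) : ℂ) * ((leadCoeff m / leadCoeff J : ℝ) : ℂ) *
      (sqrtCoeff k : ℂ) * x ^ k‖ ≤ 2 * C * (i + 1) * ((k + 1) * ρ ^ k) := by
  have hC : 0 ≤ C := (abs_nonneg e).trans he
  have hρ : 0 ≤ ρ := (norm_nonneg x).trans hx
  rw [norm_mul, norm_mul, norm_mul, norm_pow, Complex.norm_real, Complex.norm_real,
    Complex.norm_real, Real.norm_of_nonneg (leadCoeff_ratio_pos _ _).le]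
  have h1 : ‖e + 2 * (i + k) * κ‖ ≤ 2 * C * (i + 1) * (k + 1) := by
    calc ‖e + 2 * (i + k) * κ‖ ≤ |e| + |2 * (i + k) * κ| := abs_add_le _ _
      _ = |e| + 2 * (i + k) * |κ| := by rw [abs_mul, abs_of_nonneg (by positivity : (0 : ℝ) ≤ 2 * (i + k))]
      _ ≤ C + 2 * (i + k) * C := by gcongr
      _ ≤ 2 * C * (i + 1) * (k + 1) := by
        have : 0 ≤ C * (i * k) := by positivity
        nlinarith
  have h2 := abs_sqrtCoeff_le_one k
  calc _ ≤ 2 * C * (i + 1) * (k + 1) * 1 * 1 * ρ ^ k := by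
        gcongr
        · exact (leadCoeff_ratio_pos _ _).le
        · exact leadCoeff_ratio_le h
        · exact h2
    _ = _ := by ring

lemma norm_oddSum_le {J i : ℕ} {e κ C : ℝ} (he : |e| ≤ C) (hκ : |κ| ≤ C) {x : ℂ} {ρ : ℝ}
    (hx : ‖x‖ ≤ ρ) (hρ : ρ < 1) :
    ‖oddSum J i e κ x‖ ≤ 2 * C * (i + 1) * ∑' k : ℕ, ((k : ℝ) + 1) * ρ ^ k := by
  have h0 : 0 ≤ ρ := (norm_nonneg x).trans hx
  have hC : 0 ≤ C := (abs_nonneg e).trans he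
  calc ‖oddSum J i e κ x‖
      ≤ ∑ k ∈ range (J - (i + 1) + 1), 2 * C * (i + 1) * (((k : ℝ) + 1) * ρ ^ k) :=
        norm_sum_le_of_le _ fun k _ => norm_oddSum_term_le (by omega) i k he hκ hx
    _ = 2 * C * (i + 1) * ∑ k ∈ range (J - (i + 1) + 1), (((k : ℝ) + 1) * ρ ^ k) := by
        rw [Finset.mul_sum]
    _ ≤ _ := by
        gcongr
        exact (summable_succ_mul_pow h0 hρ).sum_le_tsum _ fun _ _ => by positivity

lemma eventually_abs_le {e : α → ℝ} {e₀ : ℝ} (he : Tendsto e L (𝓝 e₀)) :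
    ∀ᶠ t in L, |e t| ≤ |e₀| + 1 :=
  he.abs.eventually_le_const (by linarith)

/-- Termwise, ratios of leading coefficients tend to `1`. The constant part of the linear factor
sums to `(1 - x) ^ (1/2)`, and the part proportional to `k` to the Euler derivative of that
function. -/
lemma tendsto_oddSum {J : α → ℕ} (hJ : Tendsto J L atTop) {x : α → ℂ} {x₀ : ℂ}
    (hx : Tendsto x L (𝓝 x₀)) (h1 : ‖x₀‖ < 1) {e κ : α → ℝ} {e₀ κ₀ : ℝ}
    (he : Tendsto e L (𝓝 e₀)) (hκ : Tendsto κ L (𝓝 κ₀)) (i : ℕ) :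
    Tendsto (fun t => oddSum (J t) i (e t) (κ t) (x t)) L
      (𝓝 (((e₀ + 2 * i * κ₀) * (1 - x₀) - κ₀ * x₀) * invSqrt x₀)) := by
  have h0 := norm_nonneg x₀
  have hs : HasSum (fun k : ℕ => ((e₀ + 2 * (i + k) * κ₀ : ℝ) : ℂ) * (sqrtCoeff k : ℂ) * x₀ ^ k)
      (((e₀ + 2 * i * κ₀) * (1 - x₀) - κ₀ * x₀) * invSqrt x₀) := by
    have := ((hasSum_sqrtCoeff h1).mul_left (e₀ + 2 * i * κ₀ : ℂ)).add
      ((hasSum_mul_sqrtCoeff h1).mul_left (2 * κ₀ : ℂ))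
    rw [show ((e₀ + 2 * i * κ₀) * (1 - x₀) - κ₀ * x₀) * invSqrt x₀ =
      (e₀ + 2 * i * κ₀) * ((1 - x₀) * invSqrt x₀) +
        2 * κ₀ * (-(1 / 2) * x₀ * invSqrt x₀) by ring]
    refine hasSum_of_eq this fun k => ?_
    push_cast
    ring
  rw [← hs.tsum_eq]
  refine tendsto_sum_range_of_dominated
    (tendsto_add_atTop_nat 1 |>.comp ((tendsto_sub_atTop_nat (i + 1)).comp hJ))
    ((summable_succ_mul_pow (ρ := (‖x₀‖ + 1) / 2) (by linarith) (by linarith)).mul_left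
      (2 * max (|e₀| + 1) (|κ₀| + 1) * (i + 1)))
    (fun k => by positivity) (fun k => ?_) ?_
  · have h2 := ((tendsto_leadCoeff_ratio (i + 1 + k)).comp hJ).ofReal
    have h4 : Tendsto (fun t => e t + 2 * (i + k) * κ t) L (𝓝 (e₀ + 2 * (i + k) * κ₀)) :=
      he.add (hκ.const_mul _)
    have h3 := (((h4.ofReal).mul h2).mul_const (sqrtCoeff k : ℂ)).mul (hx.pow k)
    simp only [Complex.ofReal_one, mul_one] at h3
    refine h3.congr fun t => ?_
    simp only [Function.comp, Nat.sub_sub]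
  · filter_upwards [eventually_norm_le hx h1, eventually_abs_le he, eventually_abs_le hκ] with
      t ht het hκt k _
    exact norm_oddSum_term_le (by omega) i k (het.trans (le_max_left _ _))
      (hκt.trans (le_max_right _ _)) ht

/-- The double limit behind both parts of the kernel. -/
lemma tendsto_sum_evenSum_mul_oddSum {J : α → ℕ} (hJ : Tendsto J L atTop) {n : α → ℕ → ℕ}
    (hn : ∀ t i, n t i ≤ J t) {x y : α → ℂ} {x₀ y₀ : ℂ} (hx : Tendsto x L (𝓝 x₀))
    (hx1 : ‖x₀‖ < 1) (hy : Tendsto y L (𝓝 y₀)) (hy1 : ‖y₀‖ < 1) {e κ : α → ℝ} {e₀ κ₀ : ℝ}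
    (he : Tendsto e L (𝓝 e₀)) (hκ : Tendsto κ L (𝓝 κ₀))
    (hE : ∀ i, Tendsto (fun t => evenSum (J t) (n t i) (x t)) L (𝓝 (invSqrt x₀)))
    {a : α → ℕ → ℂ} {a₀ : ℕ → ℂ} (ha : ∀ i, Tendsto (a · i) L (𝓝 (a₀ i))) {q : ℝ} (hq0 : 0 ≤ q)
    (hq1 : q < 1) (hbound : ∀ᶠ t in L, ∀ i, ‖a t i‖ ≤ q ^ i) {S : ℂ}
    (hS : HasSum (fun i : ℕ => a₀ i * ((e₀ + 2 * i * κ₀) * (1 - y₀) - κ₀ * y₀)) S) :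
    Tendsto (fun t => ∑ i ∈ range (J t), a t i * evenSum (J t) (n t i) (x t) *
      oddSum (J t) i (e t) (κ t) (y t)) L (𝓝 (invSqrt x₀ * invSqrt y₀ * S)) := by
  have hs := hS.mul_left (invSqrt x₀ * invSqrt y₀)
  have hx0 := norm_nonneg x₀
  have hy0 := norm_nonneg y₀
  have hK : 0 ≤ ∑' k : ℕ, ((k : ℝ) + 1) * ((‖y₀‖ + 1) / 2) ^ k :=
    tsum_nonneg fun k => by positivity
  have hx2 : 0 ≤ (1 - (‖x₀‖ + 1) / 2)⁻¹ := inv_nonneg.2 (by linarith)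
  rw [← hs.tsum_eq]
  refine tendsto_sum_range_of_dominated hJ ((summable_succ_mul_pow hq0 hq1).mul_left
    ((1 - (‖x₀‖ + 1) / 2)⁻¹ * (2 * max (|e₀| + 1) (|κ₀| + 1)) *
      ∑' k : ℕ, ((k : ℝ) + 1) * ((‖y₀‖ + 1) / 2) ^ k)) (fun k => by positivity) (fun i => ?_) ?_
  · have h := ((ha i).mul (hE i)).mul (tendsto_oddSum hJ hy hy1 he hκ i)
    rwa [show a₀ i * invSqrt x₀ * (((e₀ + 2 * i * κ₀) * (1 - y₀) - κ₀ * y₀) * invSqrt y₀) =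
      invSqrt x₀ * invSqrt y₀ * (a₀ i * ((e₀ + 2 * i * κ₀) * (1 - y₀) - κ₀ * y₀)) by ring] at h
  · filter_upwards [eventually_norm_le hx hx1, eventually_norm_le hy hy1, eventually_abs_le he,
      eventually_abs_le hκ, hbound] with t hxt hyt het hκt hat i _
    rw [norm_mul, norm_mul]
    calc _ ≤ q ^ i * (1 - (‖x₀‖ + 1) / 2)⁻¹ * (2 * max (|e₀| + 1) (|κ₀| + 1) * (i + 1) *
          ∑' k : ℕ, ((k : ℝ) + 1) * ((‖y₀‖ + 1) / 2) ^ k) := by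
          gcongr
          · exact hat i
          · exact norm_evenSum_le (hn t i) hxt (by linarith)
          · exact norm_oddSum_le (het.trans (le_max_left _ _)) (hκt.trans (le_max_right _ _)) hyt
              (by linarith)
      _ = _ := by ring

end RealMahler

/-! ### The kernel sums expanded from the top degree, and their limits. -/

namespace RealMahler

open Filter Topology Finset

lemma aeval_piEven_eq (J n : ℕ) {u : ℂ} (hu : u ≠ 0) :
    Polynomial.aeval u (piEven n) = u ^ (2 * n) * leadCoeff J * evenSum J n (u ^ 2)⁻¹ := by
  rw [piEven_eq, map_sum, evenSum, Finset.mul_sum, ← Finset.sum_flip]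
  refine Finset.sum_congr rfl fun k hk => ?_
  obtain ⟨m, rfl⟩ := Nat.exists_eq_add_of_le (Nat.lt_succ_iff.1 (Finset.mem_range.1 hk))
  have h := (leadCoeff_pos J).ne'
  have h' : (leadCoeff J : ℂ) ≠ 0 := by exact_mod_cast h
  rw [Nat.add_sub_cancel_left, Nat.add_sub_cancel]
  rw [show (2 * (m : ℝ) + 1) * invSqrtCoeff m = leadCoeff m from rfl]
  simp only [map_mul, map_pow, Polynomial.aeval_C, Polynomial.aeval_X, Complex.coe_algebraMap]
  rw [inv_pow, ← pow_mul, mul_add, pow_add]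
  push_cast
  field_simp

lemma aeval_piOdd_eq {s d : ℝ} (hs : 0 < s) (hd : 0 < d) {J i : ℕ} (hi : i < J) {v : ℂ}
    (hv : v ≠ 0) :
    Polynomial.aeval v (piOdd s (J - (i + 1))) = v ^ (2 * (J - (i + 1)) + 1) *
      (d * leadCoeff J / (4 * s) : ℝ) * oddSum J i ((s - 2 * J) / d) (1 / d) (v ^ 2)⁻¹ := by
  rw [piOdd_eq s hs.ne', map_sum, oddSum, Finset.mul_sum, ← Finset.sum_flip]
  refine Finset.sum_congr rfl fun k hk => ?_
  obtain ⟨m, hm⟩ := Nat.exists_eq_add_of_le (Nat.lt_succ_iff.1 (Finset.mem_range.1 hk))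
  have h := (leadCoeff_pos J).ne'
  have h' : (leadCoeff J : ℂ) ≠ 0 := by exact_mod_cast h
  have hJ : (J : ℝ) = k + m + i + 1 := by
    have : J = k + m + i + 1 := by omega
    exact_mod_cast this
  rw [hm, Nat.add_sub_cancel_left, Nat.add_sub_cancel]
  rw [show (2 * (m : ℝ) + 1) * invSqrtCoeff m = leadCoeff m from rfl]
  simp only [map_mul, map_pow, Polynomial.aeval_C, Polynomial.aeval_X, Complex.coe_algebraMap]
  -- This is the origin of the parameters of `oddSum`: divided by `d`, the factor `s - 2 m - 2` is
  -- affine in `i + k`, with coefficients that converge even when `d → ∞`.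
  have e1 : (s - 2 * J) / d + 2 * (i + k) * (1 / d) = (s - 2 * m - 2) / d := by
    rw [hJ]
    ring
  rw [inv_pow, ← pow_mul, e1,
    show 2 * (k + m) + 1 = 2 * k + (2 * m + 1) by ring, pow_add]
  have hs' : (s : ℂ) ≠ 0 := by exact_mod_cast hs.ne'
  have hd' : (d : ℂ) ≠ 0 := by exact_mod_cast hd.ne'
  push_cast
  field_simp
  ring

/-- The normalized sum `∑ π_{2j}(u) π_{2j+1}(v)`. -/
noncomputable def mainSum (s d : ℝ) (J : ℕ) (u v : ℂ) : ℂ :=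
  (∑ j ∈ range J, Polynomial.aeval u (piEven j) * Polynomial.aeval v (piOdd s j)) /
    ((u * v) ^ (2 * J) * d)

/-- The normalized sum `∑ (s_{2j} / s_{2J}) π_{2J}(u) π_{2j+1}(v)`. -/
noncomputable def oddCorrection (s d : ℝ) (J : ℕ) (u v : ℂ) : ℂ :=
  (∑ j ∈ range J, ((lineIntegral s j / lineIntegral s J : ℝ) : ℂ) *
    (Polynomial.aeval u (piEven J) * Polynomial.aeval v (piOdd s j))) /
      ((u * v) ^ (2 * J + 1) * d)

/-- With `j = J - (i + 1)` the powers of `u` and `v` combine to `(uv) ^ (-2 (i + 1)) v`. The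
normalization by `d` cancels the `d` extracted from the odd polynomial. -/
lemma mainSum_eq {s d : ℝ} (hs : 0 < s) (hd : 0 < d) (J : ℕ) {u v : ℂ} (hu : u ≠ 0) (hv : v ≠ 0) :
    mainSum s d J u v = ((leadCoeff J ^ 2 / (4 * s) : ℝ) : ℂ) * ∑ i ∈ range J,
      (((u * v) ^ 2)⁻¹ ^ (i + 1) * v) * evenSum J (J - (i + 1)) (u ^ 2)⁻¹ *
        oddSum J i ((s - 2 * J) / d) (1 / d) (v ^ 2)⁻¹ := by
  rw [mainSum, ← Finset.sum_range_reflect, Finset.sum_div, Finset.mul_sum]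
  refine Finset.sum_congr rfl fun i hi => ?_
  have hi' := Finset.mem_range.1 hi
  rw [show J - 1 - i = J - (i + 1) by omega, aeval_piEven_eq J _ hu, aeval_piOdd_eq hs hd hi' hv]
  obtain ⟨m, hm⟩ := Nat.exists_eq_add_of_le (show i + 1 ≤ J from hi')
  have e : J - (i + 1) = m := by omega
  rw [e]
  generalize evenSum _ _ _ = E
  generalize oddSum _ _ _ _ _ = O
  have h1 : ((u * v) ^ (2 * J) : ℂ) = (u * v) ^ (2 * m) * ((u * v) ^ 2) ^ (i + 1) := by
    rw [← pow_mul, ← pow_add]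
    congr 1
    omega
  have hs' : (s : ℂ) ≠ 0 := by exact_mod_cast hs.ne'
  have hd' : (d : ℂ) ≠ 0 := by exact_mod_cast hd.ne'
  rw [h1, inv_pow, pow_succ v, mul_pow u v (2 * m)]
  push_cast
  field_simp

/-- Here the even polynomial is fixed, so the geometric decay comes from `v` alone. The ratios of
line integrals are written in `1 / d`, so that they too converge when `d → ∞`. -/
lemma oddCorrection_eq {s d : ℝ} {J : ℕ} (hd : 0 < d) (hsd : s = 2 * J + 1 + d) {u v : ℂ}
    (hu : u ≠ 0) (hv : v ≠ 0) :
    oddCorrection s d J u v = ((leadCoeff J ^ 2 / (4 * s) : ℝ) : ℂ) * ∑ i ∈ range J,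
      (((∏ l ∈ range (i + 1), (1 + 2 * l * (1 / d)) / (1 + (2 * l + 1) * (1 / d)) : ℝ) : ℂ) *
        (u⁻¹ * (v ^ 2)⁻¹ ^ (i + 1))) * evenSum J J (u ^ 2)⁻¹ *
        oddSum J i ((s - 2 * J) / d) (1 / d) (v ^ 2)⁻¹ := by
  have hs : 0 < s := by rw [hsd]; positivity
  rw [oddCorrection, ← Finset.sum_range_reflect, Finset.sum_div, Finset.mul_sum]
  refine Finset.sum_congr rfl fun i hi => ?_
  have hi' := Finset.mem_range.1 hi
  have hprod : ∏ l ∈ range (i + 1), (s - 2 * J - 1 + 2 * l) / (s - 2 * J + 2 * l) =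
      ∏ l ∈ range (i + 1), (1 + 2 * l * (1 / d)) / (1 + (2 * l + 1) * (1 / d)) := by
    refine Finset.prod_congr rfl fun l _ => ?_
    rw [hsd, show 2 * J + 1 + d - 2 * J - 1 + 2 * (l : ℝ) = d + 2 * l by ring,
      show 2 * J + 1 + d - 2 * J + 2 * (l : ℝ) = d + (2 * l + 1) by ring]
    field_simp
  rw [show J - 1 - i = J - (i + 1) by omega, lineIntegral_div (by linarith) _ hi', hprod,
    aeval_piEven_eq J _ hu, aeval_piOdd_eq hs hd hi' hv]
  obtain ⟨m, hm⟩ := Nat.exists_eq_add_of_le (show i + 1 ≤ J from hi')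
  have e : J - (i + 1) = m := by omega
  rw [e]
  generalize evenSum _ _ _ = E
  generalize oddSum _ _ _ _ _ = O
  generalize ∏ l ∈ range (i + 1), (1 + 2 * (l : ℝ) * (1 / d)) / (1 + (2 * l + 1) * (1 / d)) = R
  have h1 : ((u * v) ^ (2 * J + 1) : ℂ) =
      u ^ (2 * J) * u * (v ^ (2 * m + 1) * (v ^ 2) ^ (i + 1)) := by
    rw [mul_pow, pow_succ u, ← pow_mul, ← pow_add]
    congr 2
    omega
  have hs' : (s : ℂ) ≠ 0 := by exact_mod_cast hs.ne'
  have hd' : (d : ℂ) ≠ 0 := by exact_mod_cast hd.ne'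
  rw [h1, inv_pow]
  push_cast
  field_simp

variable {α : Type*} {L : Filter α}

/-- The asymptotic regime: `J → ∞`, `(s - 2 J) / d → e₀`, `1 / d → κ₀`, and `u`, `v` converge
to points of the exterior of the unit disk. -/
structure Regime (L : Filter α) (J : α → ℕ) (s d : α → ℝ) (u v : α → ℂ) (lam e₀ κ₀ : ℝ)
    (u₀ v₀ : ℂ) : Prop where
  atTop : Tendsto J L atTop
  s_pos : ∀ᶠ t in L, 0 < s t
  d_pos : ∀ᶠ t in L, 0 < d t
  lim_lam : Tendsto (fun t => (2 * (J t : ℝ) + 1) / s t) L (𝓝 lam)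
  lim_e : Tendsto (fun t => (s t - 2 * J t) / d t) L (𝓝 e₀)
  lim_inv : Tendsto (fun t => 1 / d t) L (𝓝 κ₀)
  lim_u : Tendsto u L (𝓝 u₀)
  lim_v : Tendsto v L (𝓝 v₀)
  one_lt_u : 1 < ‖u₀‖
  one_lt_v : 1 < ‖v₀‖

section

variable {J : α → ℕ} {s d : α → ℝ} {u v : α → ℂ} {lam e₀ κ₀ : ℝ} {u₀ v₀ : ℂ}

lemma Regime.swap (h : Regime L J s d u v lam e₀ κ₀ u₀ v₀) :
    Regime L J s d v u lam e₀ κ₀ v₀ u₀ :=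
  ⟨h.atTop, h.s_pos, h.d_pos, h.lim_lam, h.lim_e, h.lim_inv, h.lim_v, h.lim_u, h.one_lt_v,
    h.one_lt_u⟩

lemma ne_zero_of_one_lt_norm {z : ℂ} (h : 1 < ‖z‖) : z ≠ 0 :=
  norm_pos_iff.1 (zero_lt_one.trans h)

lemma norm_inv_sq_lt_one {z : ℂ} (h : 1 < ‖z‖) : ‖(z ^ 2)⁻¹‖ < 1 := by
  rw [norm_inv, norm_pow]
  exact inv_lt_one_of_one_lt₀ (one_lt_pow₀ h two_ne_zero)

lemma norm_inv_lt_one {z : ℂ} (h : 1 < ‖z‖) : ‖z⁻¹‖ < 1 := by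
  rw [norm_inv]
  exact inv_lt_one_of_one_lt₀ h

lemma one_lt_norm_mul {z w : ℂ} (hz : 1 < ‖z‖) (hw : 1 < ‖w‖) : 1 < ‖z * w‖ := by
  rw [norm_mul]
  exact one_lt_mul_of_lt_of_le hz hw.le

lemma tendsto_inv_sq {x : α → ℂ} {x₀ : ℂ} (h : Tendsto x L (𝓝 x₀)) (h1 : 1 < ‖x₀‖) :
    Tendsto (fun t => (x t ^ 2)⁻¹) L (𝓝 (x₀ ^ 2)⁻¹) :=
  (h.pow 2).inv₀ (pow_ne_zero 2 (ne_zero_of_one_lt_norm h1))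

lemma Regime.eventually_one_lt (h : Regime L J s d u v lam e₀ κ₀ u₀ v₀) :
    ∀ᶠ t in L, 1 < ‖u t‖ ∧ 1 < ‖v t‖ :=
  (h.lim_u.norm.eventually_const_lt h.one_lt_u).and (h.lim_v.norm.eventually_const_lt h.one_lt_v)

/-- The Wallis limit `2 / π` times the limit `λ` of `(2 J + 1) / s`, divided by `4`. -/
lemma Regime.tendsto_prefactor (h : Regime L J s d u v lam e₀ κ₀ u₀ v₀) :
    Tendsto (fun t => ((leadCoeff (J t) ^ 2 / (4 * s t) : ℝ) : ℂ)) L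
      (𝓝 ((lam / (2 * Real.pi) : ℝ) : ℂ)) := by
  have h1 := ((tendsto_leadCoeff_sq.comp h.atTop).mul h.lim_lam).div_const 4
  rw [show 2 / Real.pi * lam / 4 = lam / (2 * Real.pi) by ring] at h1
  refine Tendsto.ofReal (h1.congr' ?_)
  filter_upwards [h.s_pos] with t ht
  simp only [Function.comp]
  field_simp

lemma Regime.tendsto_mainSum (h : Regime L J s d u v lam e₀ κ₀ u₀ v₀) :
    Tendsto (fun t => mainSum (s t) (d t) (J t) (u t) (v t)) L
      (𝓝 (((lam / (2 * Real.pi) : ℝ) : ℂ) * (invSqrt (u₀ ^ 2)⁻¹ * invSqrt (v₀ ^ 2)⁻¹ *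
        (v₀ * ((e₀ * (1 - (v₀ ^ 2)⁻¹) - κ₀ * (v₀ ^ 2)⁻¹) / ((u₀ * v₀) ^ 2 - 1) +
          2 * κ₀ * (1 - (v₀ ^ 2)⁻¹) / ((u₀ * v₀) ^ 2 - 1) ^ 2))))) := by
  have huv := one_lt_norm_mul h.one_lt_u h.one_lt_v
  have hT := norm_inv_sq_lt_one huv
  have hq0 := norm_nonneg ((u₀ * v₀) ^ 2)⁻¹
  have hTlim := tendsto_inv_sq (h.lim_u.mul h.lim_v) huv
  have key := h.tendsto_prefactor.mul (tendsto_sum_evenSum_mul_oddSum h.atTop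
    (n := fun t i => J t - (i + 1)) (fun t i => Nat.sub_le _ _)
    (tendsto_inv_sq h.lim_u h.one_lt_u) (norm_inv_sq_lt_one h.one_lt_u)
    (tendsto_inv_sq h.lim_v h.one_lt_v) (norm_inv_sq_lt_one h.one_lt_v) h.lim_e h.lim_inv
    (fun i => tendsto_evenSum h.atTop (tendsto_inv_sq h.lim_u h.one_lt_u)
      (norm_inv_sq_lt_one h.one_lt_u) (i + 1))
    (a := fun t i => ((u t * v t) ^ 2)⁻¹ ^ (i + 1) * v t)
    (a₀ := fun i => ((u₀ * v₀) ^ 2)⁻¹ ^ (i + 1) * v₀)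
    (fun i => (hTlim.pow (i + 1)).mul h.lim_v) (q := (‖((u₀ * v₀) ^ 2)⁻¹‖ + 1) / 2)
    (by linarith) (by linarith) ?_
    (S := v₀ * ((e₀ * (1 - (v₀ ^ 2)⁻¹) - κ₀ * (v₀ ^ 2)⁻¹) / ((u₀ * v₀) ^ 2 - 1) +
          2 * κ₀ * (1 - (v₀ ^ 2)⁻¹) / ((u₀ * v₀) ^ 2 - 1) ^ 2)) ?_)
  · refine key.congr' ?_
    filter_upwards [h.eventually_one_lt, h.s_pos, h.d_pos] with t ht hs hd
    rw [mainSum_eq hs hd _ (ne_zero_of_one_lt_norm ht.1) (ne_zero_of_one_lt_norm ht.2)]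
  · filter_upwards [h.eventually_one_lt, eventually_norm_le hTlim hT] with t ht hq i
    -- The stray factor `v` is absorbed by one inverse of `uv`; the remaining factor has norm below
    -- `1`, so the bound is a pure geometric `q ^ i`.
    have h1 : ((u t * v t) ^ 2)⁻¹ ^ (i + 1) * v t =
        ((u t * v t) ^ 2)⁻¹ ^ i * ((u t * v t)⁻¹ * (u t)⁻¹) := by
      have h2 := ne_zero_of_one_lt_norm ht.1
      have h3 := ne_zero_of_one_lt_norm ht.2
      rw [pow_succ]
      field_simp
    rw [h1, norm_mul, norm_mul, norm_pow]
    calc _ ≤ ((‖((u₀ * v₀) ^ 2)⁻¹‖ + 1) / 2) ^ i * (1 * 1) := by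
          gcongr
          · exact (norm_inv_lt_one (one_lt_norm_mul ht.1 ht.2)).le
          · exact (norm_inv_lt_one ht.1).le
      _ = _ := by ring
  -- The limiting term is affine in `i` times a geometric sequence, hence the simple and double
  -- poles in `(uv)² - 1`.
  · have g1 := hasSum_geometric_of_norm_lt_one hT
    have g2 := hasSum_coe_mul_geometric_of_norm_lt_one hT
    have g3 := ((g1.mul_left (e₀ * (1 - (v₀ ^ 2)⁻¹) - κ₀ * (v₀ ^ 2)⁻¹)).add
      (g2.mul_left (2 * κ₀ * (1 - (v₀ ^ 2)⁻¹)))).mul_left (((u₀ * v₀) ^ 2)⁻¹ * v₀)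
    have hw : (u₀ * v₀) ^ 2 ≠ 0 := pow_ne_zero 2 (ne_zero_of_one_lt_norm huv)
    have hw1 : (u₀ * v₀) ^ 2 - 1 ≠ 0 := by
      intro h0
      have h1 : ‖((u₀ * v₀) ^ 2)⁻¹‖ = 1 := by rw [sub_eq_zero.1 h0, inv_one, norm_one]
      linarith
    have hv : ((u₀ * v₀) ^ 2)⁻¹ * v₀ * ((e₀ * (1 - (v₀ ^ 2)⁻¹) - κ₀ * (v₀ ^ 2)⁻¹) *
        (1 - ((u₀ * v₀) ^ 2)⁻¹)⁻¹ + 2 * κ₀ * (1 - (v₀ ^ 2)⁻¹) * (((u₀ * v₀) ^ 2)⁻¹ /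
          (1 - ((u₀ * v₀) ^ 2)⁻¹) ^ 2)) =
        v₀ * ((e₀ * (1 - (v₀ ^ 2)⁻¹) - κ₀ * (v₀ ^ 2)⁻¹) / ((u₀ * v₀) ^ 2 - 1) +
          2 * κ₀ * (1 - (v₀ ^ 2)⁻¹) / ((u₀ * v₀) ^ 2 - 1) ^ 2) := by
      generalize (u₀ * v₀) ^ 2 = w at hw hw1
      have e1 : 1 - w⁻¹ = (w - 1) / w := by field_simp
      rw [e1]
      generalize (v₀ ^ 2)⁻¹ = y
      field_simp
    rw [← hv]
    refine hasSum_of_eq g3 fun i => ?_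
    ring

/-- With `R_i` the product over `l < i`, the identity `R_{i+1} (1 + (2 i + 1) κ) = R_i (1 + 2 i κ)`
makes the term equal to `g_i - g_{i+1}` for `g_i = R_i (1 + 2 i κ) y ^ (i + 1)`. Since `g_i → 0` and
`g_0 = y`, the sum does not depend on `κ`. -/
lemma hasSum_telescope {y : ℂ} (hy : ‖y‖ < 1) {κ : ℝ} (hκ : 0 ≤ κ) :
    HasSum (fun i : ℕ =>
      ((∏ l ∈ range (i + 1), (1 + 2 * l * κ) / (1 + (2 * l + 1) * κ) : ℝ) : ℂ) * y ^ (i + 1) *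
        (((1 + κ : ℝ) + 2 * i * κ) * (1 - y) - κ * y)) y := by
  let R : ℕ → ℝ := fun i => ∏ l ∈ range i, (1 + 2 * l * κ) / (1 + (2 * l + 1) * κ)
  have hR0 : ∀ i, 0 ≤ R i := fun i => Finset.prod_nonneg fun l _ => by positivity
  have hR1 : ∀ i, R i ≤ 1 := fun i => Finset.prod_le_one (fun l _ => by positivity) fun l _ => by
    rw [div_le_one (by positivity)]
    linarith
  have hRs : ∀ i : ℕ, (R (i + 1) : ℂ) * (1 + (2 * i + 1) * κ) = R i * (1 + 2 * i * κ) := by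
    intro i
    have h1 : R (i + 1) * (1 + (2 * i + 1) * κ) = R i * (1 + 2 * i * κ) := by
      have h2 : 1 + (2 * (i : ℝ) + 1) * κ ≠ 0 := by positivity
      simp only [R]
      rw [Finset.prod_range_succ, mul_assoc, div_mul_cancel₀ _ h2]
    exact_mod_cast h1
  let g : ℕ → ℂ := fun i => (R i : ℂ) * (1 + 2 * i * κ) * y ^ (i + 1)
  have hterm : ∀ i : ℕ, (R (i + 1) : ℂ) * y ^ (i + 1) *
      (((1 + κ : ℝ) + 2 * i * κ) * (1 - y) - κ * y) = g i - g (i + 1) := by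
    intro i
    simp only [g]
    push_cast
    linear_combination y ^ (i + 1) * hRs i
  have hgn : ∀ i, ‖g i‖ ≤ (1 + 2 * κ) * ((i + 1) * ‖y‖ ^ i) := by
    intro i
    have e : ‖g i‖ = R i * (1 + 2 * i * κ) * ‖y‖ ^ (i + 1) := by
      have : g i = ((R i * (1 + 2 * i * κ) : ℝ) : ℂ) * y ^ (i + 1) := by
        simp only [g]; push_cast; ring
      rw [this, norm_mul, norm_pow, Complex.norm_real, Real.norm_of_nonneg
        (mul_nonneg (hR0 i) (by positivity))]
    rw [e, pow_succ]
    calc R i * (1 + 2 * i * κ) * (‖y‖ ^ i * ‖y‖) ≤ 1 * ((1 + 2 * κ) * (i + 1)) * (‖y‖ ^ i * 1) := by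
          gcongr
          · exact hR1 i
          · have : 0 ≤ (i : ℝ) := i.cast_nonneg
            nlinarith
      _ = _ := by ring
  have hsum : Summable fun i => ‖g i‖ :=
    Summable.of_nonneg_of_le (fun i => norm_nonneg _) hgn
      ((summable_succ_mul_pow (norm_nonneg y) hy).mul_left _)
  have hg0 : g 0 = y := by simp [g, R]
  have h1 := hsum.of_norm.hasSum
  have h2 := h1.sub ((hasSum_nat_add_iff' 1).2 h1)
  rw [Finset.sum_range_one, sub_sub_cancel, hg0] at h2
  exact hasSum_of_eq h2 fun i => (hterm i).symm

lemma Regime.tendsto_oddCorrection (h : Regime L J s d u v lam (1 + κ₀) κ₀ u₀ v₀)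
    (hsd : ∀ᶠ t in L, s t = 2 * J t + 1 + d t) (hκ : 0 ≤ κ₀) :
    Tendsto (fun t => oddCorrection (s t) (d t) (J t) (u t) (v t)) L
      (𝓝 (((lam / (2 * Real.pi) : ℝ) : ℂ) * (invSqrt (u₀ ^ 2)⁻¹ * invSqrt (v₀ ^ 2)⁻¹ *
        (u₀⁻¹ * (v₀ ^ 2)⁻¹)))) := by
  have hy := norm_inv_sq_lt_one h.one_lt_v
  have hq0 := norm_nonneg (v₀ ^ 2)⁻¹
  have hylim := tendsto_inv_sq h.lim_v h.one_lt_v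
  have key := h.tendsto_prefactor.mul (tendsto_sum_evenSum_mul_oddSum h.atTop
    (n := fun t i => J t) (fun t i => le_rfl)
    (tendsto_inv_sq h.lim_u h.one_lt_u) (norm_inv_sq_lt_one h.one_lt_u)
    hylim hy h.lim_e h.lim_inv
    (fun i => tendsto_evenSum h.atTop (tendsto_inv_sq h.lim_u h.one_lt_u)
      (norm_inv_sq_lt_one h.one_lt_u) 0)
    (a := fun t i => ((∏ l ∈ range (i + 1), (1 + 2 * l * (1 / d t)) /
      (1 + (2 * l + 1) * (1 / d t)) : ℝ) : ℂ) * ((u t)⁻¹ * (v t ^ 2)⁻¹ ^ (i + 1)))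
    (a₀ := fun i => ((∏ l ∈ range (i + 1), (1 + 2 * l * κ₀) / (1 + (2 * l + 1) * κ₀) : ℝ) : ℂ) *
      (u₀⁻¹ * (v₀ ^ 2)⁻¹ ^ (i + 1)))
    (fun i => ?_) (q := (‖(v₀ ^ 2)⁻¹‖ + 1) / 2)
    (by linarith) (by linarith) ?_
    (S := u₀⁻¹ * (v₀ ^ 2)⁻¹) ?_)
  · refine key.congr' ?_
    filter_upwards [h.eventually_one_lt, hsd, h.d_pos] with t ht hs hd
    rw [oddCorrection_eq hd hs (ne_zero_of_one_lt_norm ht.1) (ne_zero_of_one_lt_norm ht.2)]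
  · refine Tendsto.mul (Tendsto.ofReal (tendsto_finsetProd _ fun l _ => ?_))
      ((h.lim_u.inv₀ (ne_zero_of_one_lt_norm h.one_lt_u)).mul (hylim.pow _))
    exact ((h.lim_inv.const_mul _).const_add _).div ((h.lim_inv.const_mul _).const_add _)
      (by positivity)
  · filter_upwards [h.eventually_one_lt, eventually_norm_le hylim hy, h.d_pos] with t ht hq hd i
    have hr0 : 0 ≤ ∏ l ∈ range (i + 1), (1 + 2 * (l : ℝ) * (1 / d t)) /
        (1 + (2 * l + 1) * (1 / d t)) := Finset.prod_nonneg fun l _ => by positivity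
    have hr1 : ∏ l ∈ range (i + 1), (1 + 2 * (l : ℝ) * (1 / d t)) /
        (1 + (2 * l + 1) * (1 / d t)) ≤ 1 :=
      Finset.prod_le_one (fun l _ => by positivity) fun l _ => by
        have : 0 < 1 / d t := by positivity
        rw [div_le_one (by positivity)]
        linarith
    rw [norm_mul, norm_mul, norm_pow, pow_succ, Complex.norm_real, Real.norm_of_nonneg hr0]
    calc _ ≤ 1 * (1 * (((‖(v₀ ^ 2)⁻¹‖ + 1) / 2) ^ i * 1)) := by
          gcongr
          · exact (norm_inv_lt_one ht.1).le
          · exact (norm_inv_sq_lt_one ht.2).le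
      _ = _ := by ring
  · have g := (hasSum_telescope hy hκ).mul_left u₀⁻¹
    refine hasSum_of_eq g fun i => ?_
    ring

end

end RealMahler

/-! ### The normalized kernels and their common limit. -/

namespace RealMahler

open Filter Topology Finset

lemma norm_rpow_mul_weight (s : ℝ) {u v : ℂ} (hu : 1 < ‖u‖) (hv : 1 < ‖v‖) :
    ((‖u * v‖ ^ s : ℝ) : ℂ) * ((weight s u : ℂ) * (weight s v : ℂ)) = 1 := by
  have h : ‖u * v‖ ^ s * (weight s u * weight s v) = 1 := by
    rw [weight, weight, max_eq_right hu.le, max_eq_right hv.le,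
      ← Real.mul_rpow (norm_nonneg _) (norm_nonneg _), ← norm_mul,
      ← Real.rpow_add (zero_lt_one.trans (one_lt_norm_mul hu hv)), add_neg_cancel, Real.rpow_zero]
  exact_mod_cast h

lemma kernelEven_normalized {s : ℝ} {J : ℕ} (hJ : ((2 * J : ℕ) : ℝ) < s) {p : ℕ → Polynomial ℝ}
    (hmonic : ∀ n, (p n).Monic) (hdeg : ∀ n, (p n).natDegree = n) (d : ℝ) {u v : ℂ}
    (hu : 1 < ‖u‖) (hv : 1 < ‖v‖) :
    ((‖u * v‖ ^ s : ℝ) : ℂ) / (u * v) ^ (2 * J) * (kernelEven s p (2 * J) u v / d) =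
      2 * (mainSum s d J u v - mainSum s d J v u) := by
  rw [kernelEven_eq hJ hmonic hdeg, mainSum, mainSum, mul_comm v u, ← sub_div,
    ← Finset.sum_sub_distrib]
  generalize ∑ j ∈ range J, (Polynomial.aeval u (piEven j) * Polynomial.aeval v (piOdd s j) -
    Polynomial.aeval v (piEven j) * Polynomial.aeval u (piOdd s j)) = X
  linear_combination (2 * X / ((u * v) ^ (2 * J) * d)) * norm_rpow_mul_weight s hu hv

/-- The even part is normalized by one power of `uv` more than in `kernelEven_normalized`, hence the
factor `(uv)⁻¹`; that power is already built into `oddCorrection`. -/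
lemma kernelOdd_normalized {s : ℝ} {J : ℕ} (hJ : ((2 * J : ℕ) : ℝ) < s) {p : ℕ → Polynomial ℝ}
    (hmonic : ∀ n, (p n).Monic) (hdeg : ∀ n, (p n).natDegree = n) (d : ℝ) {u v : ℂ}
    (hu : 1 < ‖u‖) (hv : 1 < ‖v‖) :
    ((‖u * v‖ ^ s : ℝ) : ℂ) / (u * v) ^ (2 * J + 1) * (kernelOdd s p J u v / d) =
      2 * (u * v)⁻¹ * (mainSum s d J u v - mainSum s d J v u) -
        2 * (oddCorrection s d J u v - oddCorrection s d J v u) := by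
  have h := kernelEven_normalized hJ hmonic hdeg d hu hv
  have hsum : ∑ j ∈ range J, ((lineIntegral s j / lineIntegral s J : ℝ) : ℂ) *
      (wPiEven s J u * wPiOdd s j v - wPiEven s J v * wPiOdd s j u) =
      (weight s u : ℂ) * (weight s v : ℂ) *
        (∑ j ∈ range J, ((lineIntegral s j / lineIntegral s J : ℝ) : ℂ) *
          (Polynomial.aeval u (piEven J) * Polynomial.aeval v (piOdd s j)) -
        ∑ j ∈ range J, ((lineIntegral s j / lineIntegral s J : ℝ) : ℂ) *
          (Polynomial.aeval v (piEven J) * Polynomial.aeval u (piOdd s j))) := by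
    rw [← Finset.sum_sub_distrib, Finset.mul_sum]
    refine Finset.sum_congr rfl fun j _ => ?_
    unfold wPiEven wPiOdd
    ring
  rw [mul_right_comm, ← h, kernelOdd, hsum, oddCorrection, oddCorrection, mul_comm v u]
  generalize ∑ j ∈ range J, ((lineIntegral s j / lineIntegral s J : ℝ) : ℂ) *
    (Polynomial.aeval u (piEven J) * Polynomial.aeval v (piOdd s j)) = X
  generalize ∑ j ∈ range J, ((lineIntegral s j / lineIntegral s J : ℝ) : ℂ) *
    (Polynomial.aeval v (piEven J) * Polynomial.aeval u (piOdd s j)) = Y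
  linear_combination (-2 * (X - Y) / ((u * v) ^ (2 * J + 1) * d)) * norm_rpow_mul_weight s hu hv

/-- The limit of the normalized kernel. -/
noncomputable def limitKernel (lam κ : ℝ) (u v : ℂ) : ℂ :=
  ((lam / Real.pi : ℝ) : ℂ) * (1 + (κ : ℂ) / (u * v - 1)) * (1 / (u * v - 1)) *
    ((v - u) / (sqrtOut u * sqrtOut v))

lemma limitKernel_eq (lam κ : ℝ) (u v : ℂ) :
    limitKernel lam κ u v = ((lam / Real.pi : ℝ) : ℂ) * (1 + (κ : ℂ) / (u * v - 1)) *
      (1 / (u * v - 1)) * ((v - u) / (u * v)) * (invSqrt (u ^ 2)⁻¹ * invSqrt (v ^ 2)⁻¹) := by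
  unfold limitKernel sqrtOut invSqrt
  rw [one_div (u ^ 2), one_div (v ^ 2)]
  generalize (1 - (u ^ 2)⁻¹) ^ (1 / 2 : ℂ) = a
  generalize (1 - (v ^ 2)⁻¹) ^ (1 / 2 : ℂ) = b
  rw [mul_mul_mul_comm u a v b, ← div_div]
  ring

section

variable {α : Type*} {L : Filter α} {J : α → ℕ} {s d : α → ℝ} {u v : α → ℂ} {lam κ₀ : ℝ}
  {u₀ v₀ : ℂ}

lemma mul_sq_sub_one_ne_zero {u v : ℂ} (hu : 1 < ‖u‖) (hv : 1 < ‖v‖) :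
    u * v - 1 ≠ 0 ∧ u * v + 1 ≠ 0 := by
  have h := one_lt_norm_mul hu hv
  constructor
  · intro h0
    rw [sub_eq_zero.1 h0, norm_one] at h
    exact lt_irrefl _ h
  · intro h0
    rw [eq_neg_of_add_eq_zero_left h0, norm_neg, norm_one] at h
    exact lt_irrefl _ h

/-- Antisymmetrization turns `v (1 - v⁻²)` into `(v - u) (uv + 1) / (uv)` and `v⁻¹` into `-(v - u) /
(uv)`. The factors `uv + 1` then cancel from all denominators. -/
lemma Regime.tendsto_even (h : Regime L J s d u v lam 1 κ₀ u₀ v₀) :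
    Tendsto (fun t => 2 * (mainSum (s t) (d t) (J t) (u t) (v t) -
      mainSum (s t) (d t) (J t) (v t) (u t))) L (𝓝 (limitKernel lam κ₀ u₀ v₀)) := by
  have key := (h.tendsto_mainSum.sub h.swap.tendsto_mainSum).const_mul (2 : ℂ)
  convert key using 2
  rw [limitKernel_eq]
  have hu := ne_zero_of_one_lt_norm h.one_lt_u
  have hv := ne_zero_of_one_lt_norm h.one_lt_v
  obtain ⟨h1, h2⟩ := mul_sq_sub_one_ne_zero h.one_lt_u h.one_lt_v
  rw [mul_comm v₀ u₀, show (u₀ * v₀) ^ 2 - 1 = (u₀ * v₀ - 1) * (u₀ * v₀ + 1) by ring]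
  generalize invSqrt (u₀ ^ 2)⁻¹ = A
  generalize invSqrt (v₀ ^ 2)⁻¹ = B
  have hpi : (Real.pi : ℂ) ≠ 0 := by exact_mod_cast Real.pi_ne_zero
  push_cast
  field_simp
  ring

/-- With `w = uv` and common factors dropped, the main part gives `(v - u) / w²` times `1 / (w - 1)
+ κ w / (w - 1)²`, and the correction adds `(v - u) / w²`. The total is the even limit. -/
lemma Regime.tendsto_odd (h : Regime L J s d u v lam (1 + κ₀) κ₀ u₀ v₀)
    (hsd : ∀ᶠ t in L, s t = 2 * J t + 1 + d t) (hκ : 0 ≤ κ₀) :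
    Tendsto (fun t => 2 * (u t * v t)⁻¹ * (mainSum (s t) (d t) (J t) (u t) (v t) -
        mainSum (s t) (d t) (J t) (v t) (u t)) -
        2 * (oddCorrection (s t) (d t) (J t) (u t) (v t) -
          oddCorrection (s t) (d t) (J t) (v t) (u t))) L (𝓝 (limitKernel lam κ₀ u₀ v₀)) := by
  have hu := ne_zero_of_one_lt_norm h.one_lt_u
  have hv := ne_zero_of_one_lt_norm h.one_lt_v
  have key := ((((h.lim_u.mul h.lim_v).inv₀ (mul_ne_zero hu hv)).const_mul 2).mul
    (h.tendsto_mainSum.sub h.swap.tendsto_mainSum)).sub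
    (((h.tendsto_oddCorrection hsd hκ).sub (h.swap.tendsto_oddCorrection hsd hκ)).const_mul 2)
  convert key using 2
  rw [limitKernel_eq]
  obtain ⟨h1, h2⟩ := mul_sq_sub_one_ne_zero h.one_lt_u h.one_lt_v
  rw [mul_comm v₀ u₀, show (u₀ * v₀) ^ 2 - 1 = (u₀ * v₀ - 1) * (u₀ * v₀ + 1) by ring]
  generalize invSqrt (u₀ ^ 2)⁻¹ = A
  generalize invSqrt (v₀ ^ 2)⁻¹ = B
  have hpi : (Real.pi : ℂ) ≠ 0 := by exact_mod_cast Real.pi_ne_zero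
  push_cast
  field_simp
  ring

end

/-! ### Continuity of the limit and locally uniform convergence. -/

lemma continuousAt_sqrtOut {u : ℂ} (hu : 1 < ‖u‖) : ContinuousAt sqrtOut u := by
  have h0 := ne_zero_of_one_lt_norm hu
  refine continuousAt_id.mul (ContinuousAt.cpow ?_ continuousAt_const ?_)
  · exact continuousAt_const.sub (continuousAt_const.div (continuousAt_id.pow 2)
      (pow_ne_zero 2 h0))
  · refine Or.inl ?_
    have h1 := norm_inv_sq_lt_one hu
    have h2 := (Complex.re_le_norm ((u ^ 2)⁻¹))
    rw [Complex.sub_re, Complex.one_re, one_div]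
    linarith

lemma sqrtOut_ne_zero {u : ℂ} (hu : 1 < ‖u‖) : sqrtOut u ≠ 0 := by
  have h0 := ne_zero_of_one_lt_norm hu
  refine mul_ne_zero h0 ?_
  rw [Complex.cpow_ne_zero_iff]
  refine Or.inl fun h => ?_
  have h1 := norm_inv_sq_lt_one hu
  rw [← one_div, ← sub_eq_zero.1 h, norm_one] at h1
  exact lt_irrefl _ h1

lemma continuousOn_limitKernel (lam κ : ℝ) :
    ContinuousOn (fun w : ℂ × ℂ => limitKernel lam κ w.1 w.2) (exterior ×ˢ exterior) := by
  intro w hw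
  have h1 : 1 < ‖w.1‖ := hw.1
  have h2 : 1 < ‖w.2‖ := hw.2
  have h3 := (mul_sq_sub_one_ne_zero h1 h2).1
  have e1 : ContinuousAt (fun w : ℂ × ℂ => sqrtOut w.1) w :=
    (continuousAt_sqrtOut h1).comp continuousAt_fst
  have e2 : ContinuousAt (fun w : ℂ × ℂ => sqrtOut w.2) w :=
    (continuousAt_sqrtOut h2).comp continuousAt_snd
  have e3 : ContinuousAt (fun w : ℂ × ℂ => w.1 * w.2 - 1) w := by fun_prop
  unfold limitKernel
  exact (((continuousAt_const.mul (continuousAt_const.add (continuousAt_const.div e3 h3))).mul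
    (continuousAt_const.div e3 h3)).mul ((continuousAt_snd.sub continuousAt_fst).div (e1.mul e2)
      (mul_ne_zero (sqrtOut_ne_zero h1) (sqrtOut_ne_zero h2)))).continuousWithinAt

/-- Near `w` both `F` and `f` tend to the same value `f w`, so the pair enters every entourage. -/
lemma tendstoLocallyUniformlyOn_of_tendsto {X : Type*} [TopologicalSpace X] {F : ℕ → X → ℂ}
    {f : X → ℂ} {S : Set X} (hf : ContinuousOn f S)
    (h : ∀ w ∈ S, Tendsto (fun q : ℕ × X => F q.1 q.2) (atTop ×ˢ 𝓝[S] w) (𝓝 (f w))) :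
    TendstoLocallyUniformlyOn F f atTop S := by
  rw [tendstoLocallyUniformlyOn_iff_filter]
  intro w hw
  rw [tendstoUniformlyOnFilter_iff_tendsto]
  have h1 : Tendsto (fun q : ℕ × X => f q.2) (atTop ×ˢ 𝓝[S] w) (𝓝 (f w)) :=
    (hf w hw).tendsto.comp tendsto_snd
  exact (h1.prodMk_nhds (h w hw)).mono_right (nhds_le_uniformity _)

section

variable {s : ℕ → ℝ} {lam : ℝ} {c : EReal}

lemma tendsto_inv_sub (hc1 : 1 ≤ c)
    (hc : Tendsto (fun N : ℕ => ((s N - N : ℝ) : EReal)) atTop (𝓝 c)) :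
    Tendsto (fun N : ℕ => 1 / (s N - N)) atTop (𝓝 (c⁻¹).toReal) := by
  simp only [one_div]
  induction c with
  | bot => exact absurd hc1 (not_le.2 (EReal.bot_lt_coe 1))
  | top =>
    rw [EReal.inv_top, EReal.toReal_zero]
    exact (EReal.tendsto_coe_nhds_top_iff.1 hc).inv_tendsto_atTop
  | coe c =>
    have h1 : (1 : ℝ) ≤ c := by exact_mod_cast hc1
    rw [← EReal.coe_inv, EReal.toReal_coe]
    exact (EReal.tendsto_coe.1 hc).inv₀ (by linarith)

lemma inv_toReal_nonneg (hc1 : 1 ≤ c) : 0 ≤ (c⁻¹).toReal :=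
  EReal.toReal_nonneg (EReal.inv_nonneg_of_nonneg (zero_le_one.trans hc1))

/-- The normalized kernel converges along every approach to a point of the exterior. -/
lemma tendsto_kernel_normalized (hs : ∀ N : ℕ, (N : ℝ) < s N)
    (hlam : Tendsto (fun N : ℕ => (N : ℝ) / s N) atTop (𝓝 lam)) (hc1 : 1 ≤ c)
    (hc : Tendsto (fun N : ℕ => ((s N - N : ℝ) : EReal)) atTop (𝓝 c))
    {p : ℕ → ℕ → Polynomial ℝ} (hmonic : ∀ N n, (p N n).Monic)
    (hdeg : ∀ N n, (p N n).natDegree = n) {w : ℂ × ℂ} (h1 : 1 < ‖w.1‖) (h2 : 1 < ‖w.2‖) :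
    Tendsto (fun q : ℕ × (ℂ × ℂ) => ((‖q.2.1 * q.2.2‖ ^ s q.1 : ℝ) : ℂ) / (q.2.1 * q.2.2) ^ q.1 *
        (kernel (s q.1) (p q.1) q.1 q.2.1 q.2.2 / ((s q.1 - q.1 : ℝ) : ℂ)))
      (atTop ×ˢ 𝓝 w) (𝓝 (limitKernel lam (c⁻¹).toReal w.1 w.2)) := by
  have hspos : ∀ N, 0 < s N := fun N => (Nat.cast_nonneg N).trans_lt (hs N)
  have hinv := tendsto_inv_sub hc1 hc
  have hN : Tendsto (fun q : ℕ × (ℂ × ℂ) => q.1) (atTop ×ˢ 𝓝 w) atTop := tendsto_fst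
  have hz : Tendsto (fun q : ℕ × (ℂ × ℂ) => q.2) (atTop ×ˢ 𝓝 w) (𝓝 w) := tendsto_snd
  have hhalf : Tendsto (fun N : ℕ => N / 2) atTop atTop :=
    tendsto_atTop_atTop.2 fun b => ⟨2 * b, fun a ha => by omega⟩
  have hsinv : Tendsto (fun N : ℕ => 1 / s N) atTop (𝓝 0) :=
    tendsto_const_nhds.div_atTop
      (tendsto_atTop_mono (fun N => (hs N).le) tendsto_natCast_atTop_atTop)
  have hu := (continuous_fst.tendsto w).comp hz
  have hv := (continuous_snd.tendsto w).comp hz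
  have hev : ∀ᶠ q : ℕ × (ℂ × ℂ) in atTop ×ˢ 𝓝 w, 1 < ‖q.2.1‖ ∧ 1 < ‖q.2.2‖ :=
    (hu.norm.eventually_const_lt h1).and (hv.norm.eventually_const_lt h2)
  have main : Tendsto (fun q : ℕ × (ℂ × ℂ) => if Even q.1 then
        2 * (mainSum (s q.1) (s q.1 - q.1) (q.1 / 2) q.2.1 q.2.2 -
          mainSum (s q.1) (s q.1 - q.1) (q.1 / 2) q.2.2 q.2.1)
      else 2 * (q.2.1 * q.2.2)⁻¹ * (mainSum (s q.1) (s q.1 - q.1) (q.1 / 2) q.2.1 q.2.2 -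
          mainSum (s q.1) (s q.1 - q.1) (q.1 / 2) q.2.2 q.2.1) -
        2 * (oddCorrection (s q.1) (s q.1 - q.1) (q.1 / 2) q.2.1 q.2.2 -
          oddCorrection (s q.1) (s q.1 - q.1) (q.1 / 2) q.2.2 q.2.1)) (atTop ×ˢ 𝓝 w)
      (𝓝 (limitKernel lam (c⁻¹).toReal w.1 w.2)) := by
    -- Each parity class is a regime of its own along the restricted filter, with `J = N / 2` and `d
    -- = s - N`.
    refine Tendsto.if ?_ ?_
    · refine Regime.tendsto_even (L := (atTop ×ˢ 𝓝 w) ⊓ 𝓟 {q | Even q.1})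
        (J := fun q => q.1 / 2) (s := fun q => s q.1) (d := fun q => s q.1 - q.1)
        (u := fun q => q.2.1) (v := fun q => q.2.2) ?_
      have hle : (atTop ×ˢ 𝓝 w) ⊓ 𝓟 {q : ℕ × (ℂ × ℂ) | Even q.1} ≤ atTop ×ˢ 𝓝 w := inf_le_left
      have hmem : ∀ᶠ q : ℕ × (ℂ × ℂ) in (atTop ×ˢ 𝓝 w) ⊓ 𝓟 {q | Even q.1},
          (q.1 : ℝ) = 2 * ((q.1 / 2 : ℕ) : ℝ) := by
        filter_upwards [mem_inf_of_right (mem_principal_self _)] with q hq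
        have hq : Even q.1 := hq
        have : q.1 = 2 * (q.1 / 2) := (Nat.two_mul_div_two_of_even hq).symm
        exact_mod_cast this
      refine ⟨(hhalf.comp hN).mono_left hle, Eventually.of_forall fun q => hspos _,
        Eventually.of_forall fun q => sub_pos.2 (hs _), ?_, ?_, (hinv.comp hN).mono_left hle,
        hu.mono_left hle, hv.mono_left hle, h1, h2⟩
      -- For even `N` the regime's numerator `2 J + 1` is `N + 1`; the excess `1 / s` tends to `0`.
      · have := ((hlam.add hsinv).comp hN).mono_left hle
        rw [add_zero] at this
        refine this.congr' ?_
        filter_upwards [hmem] with q hq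
        rw [← hq]
        simp only [Function.comp]
        ring
      · refine tendsto_const_nhds.congr' ?_
        filter_upwards [hmem] with q hq
        rw [← hq, div_self (sub_pos.2 (hs _)).ne']
    · have hle : (atTop ×ˢ 𝓝 w) ⊓ 𝓟 {q : ℕ × (ℂ × ℂ) | ¬Even q.1} ≤ atTop ×ˢ 𝓝 w := inf_le_left
      have hmem : ∀ᶠ q : ℕ × (ℂ × ℂ) in (atTop ×ˢ 𝓝 w) ⊓ 𝓟 {q | ¬Even q.1},
          (q.1 : ℝ) = 2 * ((q.1 / 2 : ℕ) : ℝ) + 1 := by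
        filter_upwards [mem_inf_of_right (mem_principal_self _)] with q hq
        have hq : Odd q.1 := Nat.not_even_iff_odd.1 hq
        have : q.1 = 2 * (q.1 / 2) + 1 := (Nat.two_mul_div_two_add_one_of_odd hq).symm
        exact_mod_cast this
      refine Regime.tendsto_odd (L := (atTop ×ˢ 𝓝 w) ⊓ 𝓟 {q | ¬Even q.1})
        (J := fun q => q.1 / 2) (s := fun q => s q.1) (d := fun q => s q.1 - q.1)
        (u := fun q => q.2.1) (v := fun q => q.2.2) ?_ ?_ (inv_toReal_nonneg hc1)
      · refine ⟨(hhalf.comp hN).mono_left hle, Eventually.of_forall fun q => hspos _,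
          Eventually.of_forall fun q => sub_pos.2 (hs _), ?_, ?_, (hinv.comp hN).mono_left hle,
          hu.mono_left hle, hv.mono_left hle, h1, h2⟩
        · refine ((hlam.comp hN).mono_left hle).congr' ?_
          filter_upwards [hmem] with q hq
          rw [← hq]
          rfl
        -- For odd `N`, `s - 2 J = d + 1`, so the ratio is `1 + 1 / d`; for even `N` it was exactly
        -- `1`.
        · refine (((hinv.comp hN).mono_left hle).const_add 1).congr' ?_
          filter_upwards [hmem] with q hq
          have h3 := (sub_pos.2 (hs q.1)).ne'
          simp only [Function.comp]
          rw [show s q.1 - 2 * ((q.1 / 2 : ℕ) : ℝ) = (s q.1 - q.1) + 1 by linarith]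
          field_simp
      · filter_upwards [hmem] with q hq
        linarith
  refine main.congr' ?_
  filter_upwards [hev] with q hq
  split_ifs with he
  · obtain ⟨J, hJ⟩ := he.two_dvd
    rw [kernel, if_pos he]
    have hlt := hs q.1
    rw [show q.1 / 2 = J by omega]
    rw [hJ] at hlt
    have := kernelEven_normalized (p := p q.1) hlt (hmonic _) (hdeg _) (s (2 * J) - (2 * J : ℕ))
      hq.1 hq.2
    rw [hJ] at this ⊢
    exact this.symm
  · obtain ⟨J, hJ⟩ := Nat.not_even_iff_odd.1 he
    rw [kernel, if_neg he]
    have hlt := hs q.1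
    rw [show q.1 / 2 = J by omega]
    rw [hJ] at hlt ⊢
    have hlt2 : ((2 * J : ℕ) : ℝ) < s (2 * J + 1) := by push_cast at hlt ⊢; linarith
    exact (kernelOdd_normalized hlt2 (hmonic _) (hdeg _) _ hq.1 hq.2).symm

end

section

variable {s : ℕ → ℝ} {p : ℕ → ℕ → Polynomial ℝ}

/-- Both consequences of the main limit come from this change of normalization: the extra factor
tends to `0` if `c = ∞` and to `c |uv| ^ (-c)` otherwise. -/
lemma kernel_eq_normalized_mul {N : ℕ} (hs : (N : ℝ) < s N) {u v : ℂ} (hu : 1 < ‖u‖)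
    (hv : 1 < ‖v‖) (K : ℂ) :
    ((‖u * v‖ ^ N : ℝ) : ℂ) / (u * v) ^ N * K =
      ((‖u * v‖ ^ s N : ℝ) : ℂ) / (u * v) ^ N * (K / ((s N - N : ℝ) : ℂ)) *
        (((s N - N) * ‖u * v‖ ^ (-(s N - N)) : ℝ) : ℂ) := by
  have hpos := zero_lt_one.trans (one_lt_norm_mul hu hv)
  have hd : ((s N - N : ℝ) : ℂ) ≠ 0 := by exact_mod_cast (sub_pos.2 hs).ne'
  have h : ‖u * v‖ ^ N = ‖u * v‖ ^ s N * ‖u * v‖ ^ (-(s N - N)) := by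
    rw [← Real.rpow_add hpos, ← Real.rpow_natCast]
    congr 1
    ring
  rw [h, Complex.ofReal_mul, Complex.ofReal_mul (s N - N)]
  field_simp

/-- The kernel has the norm of its normalized form times `d |uv| ^ (-d)`, `d = s - N`. For a `ρ`
strictly between `1` and `‖w.1 * w.2‖`, this factor is at most `d ρ ^ (-d)` near `w`, which tends to
`0`. -/
lemma tendsto_kernel_zero (hs : ∀ N : ℕ, (N : ℝ) < s N) {w : ℂ × ℂ} {l : ℂ}
    (h : Tendsto (fun q : ℕ × (ℂ × ℂ) => ((‖q.2.1 * q.2.2‖ ^ s q.1 : ℝ) : ℂ) /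
      (q.2.1 * q.2.2) ^ q.1 * (kernel (s q.1) (p q.1) q.1 q.2.1 q.2.2 / ((s q.1 - q.1 : ℝ) : ℂ)))
        (atTop ×ˢ 𝓝[exterior ×ˢ exterior] w) (𝓝 l))
    (hd : Tendsto (fun N : ℕ => s N - N) atTop atTop) (hw : w ∈ exterior ×ˢ exterior) :
    Tendsto (fun q : ℕ × (ℂ × ℂ) => kernel (s q.1) (p q.1) q.1 q.2.1 q.2.2)
      (atTop ×ˢ 𝓝[exterior ×ˢ exterior] w) (𝓝 0) := by
  have h1 := one_lt_norm_mul hw.1 hw.2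
  obtain ⟨ρ, hρ1, hρ⟩ := exists_between h1
  have hρ0 : 0 < ρ := by linarith
  have hlog : 0 < Real.log ρ := Real.log_pos hρ1
  have hz : Tendsto (fun q : ℕ × (ℂ × ℂ) => q.2) (atTop ×ˢ 𝓝[exterior ×ˢ exterior] w)
      (𝓝[exterior ×ˢ exterior] w) := tendsto_snd
  have hnorm : Tendsto (fun q : ℕ × (ℂ × ℂ) => ‖q.2.1 * q.2.2‖)
      (atTop ×ˢ 𝓝[exterior ×ˢ exterior] w) (𝓝 ‖w.1 * w.2‖) :=
    ((by fun_prop : Continuous fun z : ℂ × ℂ => ‖z.1 * z.2‖).tendsto w).comp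
      (hz.mono_right nhdsWithin_le_nhds)
  have hexp : Tendsto (fun q : ℕ × (ℂ × ℂ) => (s q.1 - q.1) * ρ ^ (-(s q.1 - q.1)))
      (atTop ×ˢ 𝓝[exterior ×ˢ exterior] w) (𝓝 0) := by
    refine ((tendsto_rpow_mul_exp_neg_mul_atTop_nhds_zero 1 _ hlog).comp
      (hd.comp tendsto_fst)).congr fun q => ?_
    simp only [Function.comp]
    rw [Real.rpow_one, Real.rpow_def_of_pos hρ0]
    ring_nf
  have hprod := h.norm.mul hexp
  rw [mul_zero] at hprod
  refine squeeze_zero_norm' ?_ hprod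
  filter_upwards [hnorm.eventually_const_lt hρ, hz.eventually eventually_mem_nhdsWithin] with q hq hqm
  have hu : 1 < ‖q.2.1‖ := hqm.1
  have hv : 1 < ‖q.2.2‖ := hqm.2
  have hpos : 0 < ‖q.2.1 * q.2.2‖ := hρ0.trans hq
  have hd0 : 0 < s q.1 - q.1 := sub_pos.2 (hs q.1)
  have e := congrArg norm (kernel_eq_normalized_mul (s := s) (hs q.1) hu hv
    (kernel (s q.1) (p q.1) q.1 q.2.1 q.2.2))
  rw [norm_mul, norm_div, norm_pow, Complex.norm_real, norm_pow, norm_norm,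
    div_self (pow_ne_zero _ hpos.ne'), one_mul, norm_mul (_ * _) (Complex.ofReal _),
    Complex.norm_real, Real.norm_of_nonneg (by positivity)] at e
  rw [e]
  gcongr ?_ * (?_ * ?_)
  exact Real.rpow_le_rpow_of_nonpos hρ0 hq.le (by linarith)

lemma lam_eq_one {lam c : ℝ} (hs : ∀ N : ℕ, (N : ℝ) < s N)
    (hlam : Tendsto (fun N : ℕ => (N : ℝ) / s N) atTop (𝓝 lam))
    (hc : Tendsto (fun N : ℕ => s N - N) atTop (𝓝 c)) : lam = 1 := by
  refine tendsto_nhds_unique hlam ?_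
  have h1 : Tendsto (fun N : ℕ => 1 - (s N - N) / s N) atTop (𝓝 (1 - 0)) :=
    tendsto_const_nhds.sub (hc.div_atTop
      (tendsto_atTop_mono (fun N => (hs N).le) tendsto_natCast_atTop_atTop))
  rw [sub_zero] at h1
  refine h1.congr fun N => ?_
  have : s N ≠ 0 := ((Nat.cast_nonneg N).trans_lt (hs N)).ne'
  field_simp
  ring

lemma tendstoLocallyUniformlyOn_kernel (hs : ∀ N : ℕ, (N : ℝ) < s N) {c : ℝ}
    (hc : Tendsto (fun N : ℕ => s N - N) atTop (𝓝 c)) (hc0 : 0 < c)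
    (h : ∀ w ∈ exterior ×ˢ exterior, Tendsto (fun q : ℕ × (ℂ × ℂ) =>
      ((‖q.2.1 * q.2.2‖ ^ s q.1 : ℝ) : ℂ) / (q.2.1 * q.2.2) ^ q.1 *
        (kernel (s q.1) (p q.1) q.1 q.2.1 q.2.2 / ((s q.1 - q.1 : ℝ) : ℂ)))
          (atTop ×ˢ 𝓝[exterior ×ˢ exterior] w) (𝓝 (limitKernel 1 c⁻¹ w.1 w.2))) :
    TendstoLocallyUniformlyOn
      (fun (N : ℕ) (w : ℂ × ℂ) => ((‖w.1 * w.2‖ ^ N : ℝ) : ℂ) / (w.1 * w.2) ^ N *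
        kernel (s N) (p N) N w.1 w.2)
      (fun w : ℂ × ℂ => ((1 / Real.pi : ℝ) : ℂ) * ((c : ℂ) + 1 / (w.1 * w.2 - 1)) *
        ((1 / ‖w.1 * w.2‖ ^ c : ℝ) : ℂ) * (1 / (w.1 * w.2 - 1)) *
          ((w.2 - w.1) / (sqrtOut w.1 * sqrtOut w.2)))
      atTop (exterior ×ˢ exterior) := by
  have hf : ∀ w : ℂ × ℂ, ((1 / Real.pi : ℝ) : ℂ) * ((c : ℂ) + 1 / (w.1 * w.2 - 1)) *
        ((1 / ‖w.1 * w.2‖ ^ c : ℝ) : ℂ) * (1 / (w.1 * w.2 - 1)) *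
          ((w.2 - w.1) / (sqrtOut w.1 * sqrtOut w.2)) =
      limitKernel 1 c⁻¹ w.1 w.2 * ((c * ‖w.1 * w.2‖ ^ (-c) : ℝ) : ℂ) := by
    intro w
    have hc' : (c : ℂ) ≠ 0 := by exact_mod_cast hc0.ne'
    -- The factor `c` is the limit of the factor `s - N` restored to the kernel.
    have e : (c : ℂ) + 1 / (w.1 * w.2 - 1) = c * (1 + ((c⁻¹ : ℝ) : ℂ) / (w.1 * w.2 - 1)) := by
      push_cast
      rw [mul_add, mul_one, ← mul_div_assoc, mul_inv_cancel₀ hc']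
    rw [e, limitKernel, Real.rpow_neg (norm_nonneg _)]
    push_cast
    ring
  have hpow : ∀ w ∈ exterior ×ˢ exterior, ‖w.1 * w.2‖ ≠ 0 := fun w hw =>
    (zero_lt_one.trans (one_lt_norm_mul hw.1 hw.2)).ne'
  simp only [hf]
  refine tendstoLocallyUniformlyOn_of_tendsto ((continuousOn_limitKernel _ _).mul
    (Complex.continuous_ofReal.comp_continuousOn (continuousOn_const.mul
      (ContinuousOn.rpow_const (by fun_prop) fun w hw => Or.inl (hpow w hw))))) fun w hw => ?_
  have hz : Tendsto (fun q : ℕ × (ℂ × ℂ) => q.2) (atTop ×ˢ 𝓝[exterior ×ˢ exterior] w)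
      (𝓝[exterior ×ˢ exterior] w) := tendsto_snd
  have hnorm : Tendsto (fun q : ℕ × (ℂ × ℂ) => ‖q.2.1 * q.2.2‖)
      (atTop ×ˢ 𝓝[exterior ×ˢ exterior] w) (𝓝 ‖w.1 * w.2‖) :=
    ((by fun_prop : Continuous fun z : ℂ × ℂ => ‖z.1 * z.2‖).tendsto w).comp
      (hz.mono_right nhdsWithin_le_nhds)
  have hd : Tendsto (fun q : ℕ × (ℂ × ℂ) => s q.1 - q.1)
      (atTop ×ˢ 𝓝[exterior ×ˢ exterior] w) (𝓝 c) := hc.comp tendsto_fst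
  refine ((h w hw).mul (hd.mul (hnorm.rpow hd.neg (Or.inl (hpow w hw)))).ofReal).congr' ?_
  filter_upwards [hz.eventually eventually_mem_nhdsWithin] with q hq
  exact (kernel_eq_normalized_mul (hs q.1) hq.1 hq.2 _).symm

end

end RealMahler

theorem theorem2p6 (s : ℕ → ℝ) (hs : ∀ N : ℕ, (N : ℝ) < s N)
    (lam : ℝ) (hlam : Filter.Tendsto (fun N : ℕ => (N : ℝ) / s N) Filter.atTop (nhds lam))
    (c : EReal) (hc1 : 1 ≤ c)
    (hc : Filter.Tendsto (fun N : ℕ => ((s N - N : ℝ) : EReal)) Filter.atTop (nhds c))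
    (p : ℕ → ℕ → Polynomial ℝ) (hmonic : ∀ N n, (p N n).Monic)
    (hdeg : ∀ N n, (p N n).natDegree = n) :
    TendstoLocallyUniformlyOn
      (fun (N : ℕ) (w : ℂ × ℂ) =>
        ((‖w.1 * w.2‖ ^ s N : ℝ) : ℂ) / (w.1 * w.2) ^ N *
          (RealMahler.kernel (s N) (p N) N w.1 w.2 / ((s N - N : ℝ) : ℂ)))
      (fun w : ℂ × ℂ =>
        ((lam / Real.pi : ℝ) : ℂ) * (1 + (((c⁻¹).toReal : ℝ) : ℂ) / (w.1 * w.2 - 1)) *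
          (1 / (w.1 * w.2 - 1)) *
          ((w.2 - w.1) / (RealMahler.sqrtOut w.1 * RealMahler.sqrtOut w.2)))
      Filter.atTop (RealMahler.exterior ×ˢ RealMahler.exterior) ∧
    (c = ⊤ →
      TendstoLocallyUniformlyOn
        (fun (N : ℕ) (w : ℂ × ℂ) => RealMahler.kernel (s N) (p N) N w.1 w.2)
        (fun _ : ℂ × ℂ => (0 : ℂ))
        Filter.atTop (RealMahler.exterior ×ˢ RealMahler.exterior)) ∧
    (c ≠ ⊤ →
      TendstoLocallyUniformlyOn
        (fun (N : ℕ) (w : ℂ × ℂ) =>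
          ((‖w.1 * w.2‖ ^ N : ℝ) : ℂ) / (w.1 * w.2) ^ N *
            RealMahler.kernel (s N) (p N) N w.1 w.2)
        (fun w : ℂ × ℂ =>
          ((1 / Real.pi : ℝ) : ℂ) * ((c.toReal : ℂ) + 1 / (w.1 * w.2 - 1)) *
            ((1 / ‖w.1 * w.2‖ ^ c.toReal : ℝ) : ℂ) * (1 / (w.1 * w.2 - 1)) *
            ((w.2 - w.1) / (RealMahler.sqrtOut w.1 * RealMahler.sqrtOut w.2)))
        Filter.atTop (RealMahler.exterior ×ˢ RealMahler.exterior)) := by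
  open Filter Topology RealMahler in
  have hkey : ∀ w ∈ exterior ×ˢ exterior, Tendsto (fun q : ℕ × (ℂ × ℂ) =>
      ((‖q.2.1 * q.2.2‖ ^ s q.1 : ℝ) : ℂ) / (q.2.1 * q.2.2) ^ q.1 *
        (kernel (s q.1) (p q.1) q.1 q.2.1 q.2.2 / ((s q.1 - q.1 : ℝ) : ℂ)))
      (atTop ×ˢ 𝓝[exterior ×ˢ exterior] w) (𝓝 (limitKernel lam (c⁻¹).toReal w.1 w.2)) :=
    fun w hw => (tendsto_kernel_normalized hs hlam hc1 hc hmonic hdeg hw.1 hw.2).mono_left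
      (Filter.prod_mono_right _ nhdsWithin_le_nhds)
  refine ⟨RealMahler.tendstoLocallyUniformlyOn_of_tendsto
    (RealMahler.continuousOn_limitKernel _ _) hkey, fun htop => ?_, fun htop => ?_⟩
  · refine RealMahler.tendstoLocallyUniformlyOn_of_tendsto continuousOn_const fun w hw => ?_
    subst htop
    exact RealMahler.tendsto_kernel_zero hs (hkey w hw) (EReal.tendsto_coe_nhds_top_iff.1 hc) hw
  · lift c to ℝ using ⟨htop, (lt_of_lt_of_le (EReal.bot_lt_coe 1) hc1).ne'⟩
    have hc' := EReal.tendsto_coe.1 hc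
    have hc1' : (1 : ℝ) ≤ c := by exact_mod_cast hc1
    -- A finite `c` forces `λ = 1`, which is why `λ` is absent from the last limit.
    obtain rfl : lam = 1 := RealMahler.lam_eq_one hs hlam hc'
    simp only [← EReal.coe_inv, EReal.toReal_coe] at hkey ⊢
    exact RealMahler.tendstoLocallyUniformlyOn_kernel hs hc' (by linarith) hkey
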